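/- **Notation.** For a Dirichlet polynomial $P(s)=\sum_{n\ge1}a_n n^{-s}$ (finitely many $a_n\neq0$) let $\mathcal{B}P$ be its Bohr lift, i.e. the function on the infinite torus $\mathbb{T}^\infty$ obtained by replacing $n^{-s}=\prod_j (p_j^{-s})^{\alpha_j}$ by $\prod_j z_j^{\alpha_j}$, where $n=\prod_j p_j^{\alpha_j}$ is the prime factorisation, and let $P_\sigma(s)=P(\sigma+s)$. With $m_\infty$ the normalised Haar measure of $\mathbb{T}^\infty$ and, for $\alpha>-1$, $d\mu_\alpha(\sigma)=\frac{2^{\alpha+1}}{\Gamma(\alpha+1)}\sigma^\alpha e^{-2\sigma}\,d\sigma$ on $(0,\infty)$, put, for $1\le p,q<\infty$, $$\|P\|_{\mathcal{H}^p}=\Big(\int_{\mathbb{T}^\infty}|\mathcal{B}P|^p\,dm_\infty\Big)^{1/p},\qquad \|P\|_{\mathcal{A}^q_\alpha}=\Big(\int_0^\infty\|P_\sigma\|_{\mathcal{H}^q}^q\,d\mu_\alpha(\sigma)\Big)^{1/q}.$$ $\mathcal{H}^p$ and $\mathcal{A}^q_\alpha$ are the completions of the space of Dirichlet polynomials for these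 norms; the Dirichlet coefficients and the point evaluations at $s$ with $\operatorname{Re}s>1/2$ extend continuously to them, and their elements are viewed as Dirichlet series and as functions on $\{\operatorname{Re}s>1/2\}$. For $t>0$, the Riemann–Liouville operator acts on the series $f\in\mathcal{H}^p$ whose first coefficient $a_1$ is zero by $$I_t f(s)=\frac1{\Gamma(t)}\int_0^\infty x^{t-1}f(x+s)\,dx,\qquad \operatorname{Re}s>1/2 .$$ "$I_t:\mathcal{H}^p\to\mathcal{A}^q_\alpha$ is bounded" means that there is a constant $C$ such that for every $f\in\mathcal{H}^p$ with $a_1=0$ this integral converges absolutely for $\operatorname{Re}s>1/2$, $I_tf$ belongs to $\mathcal{A}^q_\alpha$, and $\|I_tf\|_{\mathcal{A}^q_\alpha}\le C\|f\|_{\mathcal{H}^p}$. "The identity $\mathcal{H}^p\to\mathcal{A}^q_\beta$ is bounded" means that there is a constant $C$ such that every $f\in\mathcal{H}^p$ belongs, as a function on $\{\operatorname{Re}s>1/2\}$, to $\mathcal{A}^q_\beta$ with $\|f\|_{\mathcal{A}^q_\beta}\le C\|f\|_{\mathcal{H}^p}$. **Theorem 4.1.** Let $1\le p,q<\infty$,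 $\alpha>-1$ and $t>0$. The following are equivalent: 1. $I_t:\mathcal{H}^p\to\mathcal{A}^q_\alpha$ is bounded; 2. the identity $\mathcal{H}^p\to\mathcal{A}^q_{\alpha+qt}$ is bounded; 3. $p\ge q$. (For $t=1$, $I_1f(s)=\int_s^\infty f(u)\,du$ is the classical integration operator.) -/

import Mathlib

open MeasureTheory Filter Topology
open scoped ENNReal

namespace DirichletSpaces

noncomputable section

/-! ### The infinite torus -/

instance : MeasurableSpace Circle := borel Circle

instance : BorelSpace Circle := ⟨rfl⟩

/-- The infinite torus, one circle for each prime number. -/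
abbrev InfTorus : Type := Nat.Primes → Circle

/-- The normalised Haar measure of the infinite torus. -/
def torusMeasure : Measure InfTorus :=
  Measure.haarMeasure (⊤ : TopologicalSpace.PositiveCompacts InfTorus)

instance : IsProbabilityMeasure torusMeasure :=
  ⟨by simpa [torusMeasure] using
    Measure.haarMeasure_self (K₀ := (⊤ : TopologicalSpace.PositiveCompacts InfTorus))⟩

instance : torusMeasure.IsHaarMeasure := by
  unfold torusMeasure; infer_instance

/-- The character `χ` of the positive integers attached to a point `z` of the torus: it is
completely multiplicative with `χ(p) = z_p`, so that it sends `n = ∏ p_j ^ α_j` to the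
monomial `∏ z_j ^ α_j`. -/
def torusChar (z : InfTorus) : ℕ+ →* Circle where
  toFun n := (Multiset.map z (PNat.factorMultiset n : Multiset Nat.Primes)).prod
  map_one' := by rw [PNat.factorMultiset_one]; exact Multiset.prod_zero
  map_mul' m n := by
    rw [PNat.factorMultiset_mul]
    exact (congrArg Multiset.prod (Multiset.map_add z _ _)).trans (Multiset.prod_add _ _)

lemma torusChar_prime (z : InfTorus) (p : Nat.Primes) :
    torusChar z (p : ℕ+) = z p := by
  change (Multiset.map z (PNat.factorMultiset p : Multiset Nat.Primes)).prod = _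
  rw [PNat.factorMultiset_ofPrime]
  change (Multiset.map z {p}).prod = _
  simp

lemma torusChar_mul_left (w z : InfTorus) (n : ℕ+) :
    torusChar (w * z) n = torusChar w n * torusChar z n := by
  exact Multiset.prod_map_mul (f := w) (g := z)
    (m := (PNat.factorMultiset n : Multiset Nat.Primes))

lemma continuous_torusChar (n : ℕ+) : Continuous fun z : InfTorus => torusChar z n := by
  change Continuous fun z : InfTorus =>
    (Multiset.map (fun p => z p) (PNat.factorMultiset n : Multiset Nat.Primes)).prod
  exact continuous_multiset_prod _ fun p _ => continuous_apply p

/-! ### Dirichlet polynomials and their norms -/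

/-- Dirichlet polynomials `∑ aₙ n^{-s}`, through their finitely supported coefficients. -/
abbrev DirichletPoly : Type := ℕ+ →₀ ℂ

/-- The value `∑ aₙ n^{-s}` of a Dirichlet polynomial at `s`. -/
def polyEval (s : ℂ) : DirichletPoly →ₗ[ℂ] ℂ :=
  Finsupp.linearCombination ℂ fun n : ℕ+ => ((n : ℕ) : ℂ) ^ (-s)

/-- The value `∑ aₙ χ(n) = ∑ aₙ z₁^{α₁} ⋯ z_r^{α_r}` at `z` of the Bohr lift of a Dirichlet
polynomial. -/
def bohrLift (z : InfTorus) : DirichletPoly →ₗ[ℂ] ℂ :=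
  Finsupp.linearCombination ℂ fun n : ℕ+ => (torusChar z n : ℂ)

/-- The horizontal translation `P ↦ P_σ`, `P_σ(s) = P(σ + s)`: it multiplies the `n`-th
coefficient by `n^{-σ}`. -/
def translate (σ : ℝ) : DirichletPoly →ₗ[ℂ] DirichletPoly :=
  Finsupp.linearCombination ℂ fun n : ℕ+ => Finsupp.single n (((n : ℕ) : ℂ) ^ (-(σ : ℂ)))

@[simp] lemma polyEval_single (s : ℂ) (n : ℕ+) (a : ℂ) :
    polyEval s (Finsupp.single n a) = a * ((n : ℕ) : ℂ) ^ (-s) := by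
  rw [polyEval, Finsupp.linearCombination_single, smul_eq_mul]

@[simp] lemma bohrLift_single (z : InfTorus) (n : ℕ+) (a : ℂ) :
    bohrLift z (Finsupp.single n a) = a * (torusChar z n : ℂ) := by
  rw [bohrLift, Finsupp.linearCombination_single, smul_eq_mul]

@[simp] lemma translate_single (σ : ℝ) (n : ℕ+) (a : ℂ) :
    translate σ (Finsupp.single n a) = Finsupp.single n (a * ((n : ℕ) : ℂ) ^ (-(σ : ℂ))) := by
  rw [translate, Finsupp.linearCombination_single, Finsupp.smul_single, smul_eq_mul]

lemma polyEval_translate (σ : ℝ) (s : ℂ) (P : DirichletPoly) :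
    polyEval s (translate σ P) = polyEval (σ + s) P := by
  have h : (polyEval s).comp (translate σ) = polyEval (σ + s) := by
    refine Finsupp.lhom_ext fun n a => ?_
    have hn : ((n : ℕ) : ℂ) ≠ 0 := by exact_mod_cast n.ne_zero
    simp only [LinearMap.comp_apply, translate_single, polyEval_single, neg_add,
      Complex.cpow_add _ _ hn, mul_assoc]
  exact LinearMap.congr_fun h P

lemma translate_apply (σ : ℝ) (P : DirichletPoly) (n : ℕ+) :
    translate σ P n = P n * ((n : ℕ) : ℂ) ^ (-(σ : ℂ)) := by
  have h : (Finsupp.lapply n).comp (translate σ) =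
      (((n : ℕ) : ℂ) ^ (-(σ : ℂ))) • (Finsupp.lapply n : DirichletPoly →ₗ[ℂ] ℂ) := by
    refine Finsupp.lhom_ext fun m a => ?_
    by_cases hm : m = n
    · subst hm; simp [mul_comm]
    · simp [hm]
  have := LinearMap.congr_fun h P
  simpa [mul_comm] using this

/-- The norm `‖P‖_{𝓗^p}`: the `L^p` norm of the Bohr lift on the infinite torus. -/
def hardyNorm (p : ℝ) (P : DirichletPoly) : ℝ :=
  (∫ z, ‖bohrLift z P‖ ^ p ∂torusMeasure) ^ (1 / p)

/-- The measure `dμ_α(σ) = 2^{α+1} / Γ(α+1) · σ^α e^{-2σ} dσ` on `(0, ∞)`, which is the gamma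
distribution of shape `α + 1` and rate `2`. -/
def bergmanMeasure (α : ℝ) : Measure ℝ :=
  ProbabilityTheory.gammaMeasure (α + 1) 2

/-- The norm `‖P‖_{𝓐^q_α} = (∫ ‖P_σ‖_{𝓗^q}^q dμ_α(σ))^{1/q}`. -/
def bergmanNorm (q α : ℝ) (P : DirichletPoly) : ℝ :=
  (∫ σ, hardyNorm q (translate σ P) ^ q ∂(bergmanMeasure α)) ^ (1 / q)

/-! Both are seminorms. -/

lemma rpow_integral_eq_lpNorm {X E : Type*} [MeasurableSpace X] [NormedAddCommGroup E]
    {μ : Measure X} {p : ℝ} (hp : 1 ≤ p) {f : X → E} (hf : AEStronglyMeasurable f μ) :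
    (∫ x, ‖f x‖ ^ p ∂μ) ^ (1 / p) = lpNorm f (ENNReal.ofReal p) μ := by
  have hp0 : 0 ≤ p := by linarith
  rw [lpNorm_eq_integral_norm_rpow_toReal (by simp; linarith) (by simp) hf,
    ENNReal.toReal_ofReal hp0, one_div]

lemma continuous_bohrLift (P : DirichletPoly) :
    Continuous fun z : InfTorus => bohrLift z P := by
  simp only [bohrLift, Finsupp.linearCombination_apply, Finsupp.sum]
  exact continuous_finsetSum _ fun n _ =>
    Continuous.const_smul (g := fun z => (torusChar z n : ℂ))
      (continuous_subtype_val.comp (continuous_torusChar n)) (P n)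

lemma norm_bohrLift_le (z : InfTorus) (P : DirichletPoly) :
    ‖bohrLift z P‖ ≤ P.sum fun _ a => ‖a‖ := by
  simp only [bohrLift, Finsupp.linearCombination_apply, Finsupp.sum]
  refine (norm_sum_le _ _).trans (Finset.sum_le_sum fun n _ => ?_)
  rw [norm_smul, Circle.norm_coe, mul_one]

lemma memLp_bohrLift (p : ℝ≥0∞) (P : DirichletPoly) :
    MemLp (fun z => bohrLift z P) p torusMeasure :=
  MemLp.of_bound (continuous_bohrLift P).aestronglyMeasurable _
    (ae_of_all _ fun z => norm_bohrLift_le z P)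

lemma hardyNorm_eq {p : ℝ} (hp : 1 ≤ p) (P : DirichletPoly) :
    hardyNorm p P = lpNorm (fun z => bohrLift z P) (ENNReal.ofReal p) torusMeasure :=
  rpow_integral_eq_lpNorm hp (continuous_bohrLift P).aestronglyMeasurable

lemma hardyNorm_nonneg (p : ℝ) (P : DirichletPoly) : 0 ≤ hardyNorm p P :=
  Real.rpow_nonneg (integral_nonneg fun _ => Real.rpow_nonneg (norm_nonneg _) _) _

lemma one_le_ofReal {p : ℝ} (hp : 1 ≤ p) : 1 ≤ ENNReal.ofReal p := by
  simpa using ENNReal.ofReal_le_ofReal hp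

lemma hardyNorm_add_le {p : ℝ} (hp : 1 ≤ p) (P Q : DirichletPoly) :
    hardyNorm p (P + Q) ≤ hardyNorm p P + hardyNorm p Q := by
  simp only [hardyNorm_eq hp, map_add]
  exact lpNorm_add_le (memLp_bohrLift _ P) (one_le_ofReal hp)

lemma hardyNorm_smul {p : ℝ} (hp : 1 ≤ p) (c : ℂ) (P : DirichletPoly) :
    hardyNorm p (c • P) = ‖c‖ * hardyNorm p P := by
  simp only [hardyNorm_eq hp, map_smul]
  exact lpNorm_const_smul c _ _

lemma hardyNorm_le_sum {p : ℝ} (hp : 1 ≤ p) (P : DirichletPoly) :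
    hardyNorm p P ≤ P.sum fun _ a => ‖a‖ := by
  have h0 : 0 ≤ P.sum fun _ a => ‖a‖ := Finset.sum_nonneg fun _ _ => norm_nonneg _
  rw [hardyNorm_eq hp]
  have hne : ENNReal.ofReal p ≠ 0 := by simp; linarith
  refine (lpNorm_mono_real (memLp_const (P.sum fun _ a => ‖a‖))
    fun z => norm_bohrLift_le z P).trans (le_of_eq ?_)
  rw [lpNorm_const hne (IsProbabilityMeasure.ne_zero _)]
  simp [abs_of_nonneg h0]

/-- `‖·‖_{𝓗^p}` as a seminorm on Dirichlet polynomials. -/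
def hardySeminorm (p : ℝ) (hp : 1 ≤ p) : Seminorm ℂ DirichletPoly :=
  Seminorm.of (hardyNorm p) (hardyNorm_add_le hp) (hardyNorm_smul hp)

lemma norm_natCast_cpow (n : ℕ+) (s : ℂ) : ‖((n : ℕ) : ℂ) ^ s‖ = ((n : ℕ) : ℝ) ^ s.re := by
  exact Complex.norm_natCast_cpow_of_pos n.pos s

lemma continuous_bohrLift_translate (P : DirichletPoly) :
    Continuous fun x : ℝ × InfTorus => bohrLift x.2 (translate x.1 P) := by
  have h : ∀ x : ℝ × InfTorus, bohrLift x.2 (translate x.1 P) =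
      P.sum fun n a => a * ((((n : ℕ) : ℂ) ^ (-(x.1 : ℂ))) * (torusChar x.2 n : ℂ)) := by
    intro x
    conv_lhs => rw [← Finsupp.sum_single P]
    simp only [Finsupp.sum, map_sum, translate_single, bohrLift_single, mul_assoc]
  simp only [h, Finsupp.sum]
  refine continuous_finsetSum _ fun n _ => continuous_const.mul (Continuous.mul ?_ ?_)
  · have hn : ((n : ℕ) : ℂ) ≠ 0 := by exact_mod_cast n.ne_zero
    exact Continuous.const_cpow (by fun_prop) (Or.inl hn)
  · exact continuous_subtype_val.comp ((continuous_torusChar n).comp continuous_snd)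

lemma measurable_hardyNorm_translate (p : ℝ) (P : DirichletPoly) :
    Measurable fun σ : ℝ => hardyNorm p (translate σ P) := by
  have h : StronglyMeasurable fun x : ℝ × InfTorus =>
      ‖bohrLift x.2 (translate x.1 P)‖ ^ p :=
    ((continuous_bohrLift_translate P).norm.measurable.pow_const p).stronglyMeasurable
  exact (h.integral_prod_right (ν := torusMeasure)).measurable.pow_const _

lemma bergmanMeasure_ae (α : ℝ) : ∀ᵐ σ ∂(bergmanMeasure α), 0 < σ := by
  have hneg : ∀ᵐ σ ∂(bergmanMeasure α), ¬ σ < 0 := by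
    rw [bergmanMeasure, ProbabilityTheory.gammaMeasure,
      ae_withDensity_iff (by unfold ProbabilityTheory.gammaPDF; fun_prop)]
    exact ae_of_all _ fun σ h hlt => h (ProbabilityTheory.gammaPDF_of_neg hlt)
  have hzero : ∀ᵐ σ ∂(bergmanMeasure α), σ ≠ 0 :=
    (withDensity_absolutelyContinuous _ _).ae_le (Measure.ae_ne volume 0)
  filter_upwards [hneg, hzero] with σ h1 h2
  exact lt_of_le_of_ne (not_lt.mp h1) h2.symm

lemma isProbabilityMeasure_bergmanMeasure {α : ℝ} (hα : -1 < α) :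
    IsProbabilityMeasure (bergmanMeasure α) :=
  ProbabilityTheory.isProbabilityMeasure_gammaMeasure (by linarith) (by norm_num)

lemma hardyNorm_translate_le {p : ℝ} (hp : 1 ≤ p) {σ : ℝ} (hσ : 0 ≤ σ) (P : DirichletPoly) :
    hardyNorm p (translate σ P) ≤ P.sum fun _ a => ‖a‖ := by
  refine (hardyNorm_le_sum hp _).trans ?_
  have hsub : (translate σ P).support ⊆ P.support := by
    intro n hn
    rw [Finsupp.mem_support_iff, translate_apply] at hn
    exact Finsupp.mem_support_iff.mpr (left_ne_zero_of_mul hn)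
  rw [Finsupp.sum, Finsupp.sum]
  refine (Finset.sum_le_sum_of_subset_of_nonneg hsub fun _ _ _ => norm_nonneg _).trans
    (Finset.sum_le_sum fun n _ => ?_)
  rw [translate_apply, norm_mul, norm_natCast_cpow]
  refine mul_le_of_le_one_right (norm_nonneg _) ?_
  exact Real.rpow_le_one_of_one_le_of_nonpos (by exact_mod_cast n.pos) (by simpa using hσ)

lemma memLp_hardyNorm_translate {q α : ℝ} (hq : 1 ≤ q) (hα : -1 < α) (P : DirichletPoly)
    (r : ℝ≥0∞) : MemLp (fun σ => hardyNorm q (translate σ P)) r (bergmanMeasure α) := by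
  have := isProbabilityMeasure_bergmanMeasure hα
  refine MemLp.of_bound (measurable_hardyNorm_translate q P).aestronglyMeasurable
    (P.sum fun _ a => ‖a‖) ?_
  filter_upwards [bergmanMeasure_ae α] with σ hσ
  rw [Real.norm_of_nonneg (hardyNorm_nonneg _ _)]
  exact hardyNorm_translate_le hq hσ.le P

lemma bergmanNorm_eq {q : ℝ} (hq : 1 ≤ q) (α : ℝ) (P : DirichletPoly) :
    bergmanNorm q α P =
      lpNorm (fun σ => hardyNorm q (translate σ P)) (ENNReal.ofReal q) (bergmanMeasure α) := by
  rw [← rpow_integral_eq_lpNorm hq (measurable_hardyNorm_translate q P).aestronglyMeasurable]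
  simp only [Real.norm_of_nonneg (hardyNorm_nonneg _ _), bergmanNorm]

lemma bergmanNorm_add_le {q α : ℝ} (hq : 1 ≤ q) (hα : -1 < α) (P Q : DirichletPoly) :
    bergmanNorm q α (P + Q) ≤ bergmanNorm q α P + bergmanNorm q α Q := by
  simp only [bergmanNorm_eq hq]
  refine le_trans (lpNorm_mono_real
    ((memLp_hardyNorm_translate hq hα P _).add (memLp_hardyNorm_translate hq hα Q _))
    fun σ => ?_)
    (lpNorm_add_le (memLp_hardyNorm_translate hq hα P _) (one_le_ofReal hq))
  rw [Real.norm_of_nonneg (hardyNorm_nonneg _ _), map_add]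
  exact hardyNorm_add_le hq _ _

lemma bergmanNorm_smul {q : ℝ} (hq : 1 ≤ q) (α : ℝ) (c : ℂ) (P : DirichletPoly) :
    bergmanNorm q α (c • P) = ‖c‖ * bergmanNorm q α P := by
  simp only [bergmanNorm_eq hq, map_smul, hardyNorm_smul hq]
  have := lpNorm_const_smul (𝕜 := ℝ) (p := ENNReal.ofReal q) ‖c‖
    (fun σ => hardyNorm q (translate σ P)) (bergmanMeasure α)
  simpa [Pi.smul_def] using this

/-- `‖·‖_{𝓐^q_α}` as a seminorm on Dirichlet polynomials. -/
def bergmanSeminorm (q α : ℝ) (hq : 1 ≤ q) (hα : -1 < α) : Seminorm ℂ DirichletPoly :=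
  Seminorm.of (bergmanNorm q α) (bergmanNorm_add_le hq hα) (bergmanNorm_smul hq α)

/-! ### Coefficients and point evaluations are bounded -/

lemma integrable_of_continuous {f : InfTorus → ℂ} (hf : Continuous f) :
    Integrable f torusMeasure :=
  hf.integrable_of_hasCompactSupport (HasCompactSupport.of_compactSpace f)

lemma torusChar_injective_of {m n : ℕ+} (h : ∀ z, torusChar z m = torusChar z n) : m = n := by
  classical
  have key : ∀ a b : ℕ, (∀ w : Circle, w ^ (a + b) = w ^ a) → b = 0 := by
    intro a b hw
    by_contra hb
    have hb' : (b : ℝ) ≠ 0 := by exact_mod_cast hb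
    have h1 := hw (Circle.exp (Real.pi / b))
    rw [pow_add, mul_eq_left, ← Circle.exp_nsmul, nsmul_eq_mul, mul_div_cancel₀ _ hb'] at h1
    have h2 := congrArg (fun w : Circle => (w : ℂ)) h1
    simp only [Circle.coe_exp, Complex.exp_pi_mul_I, Circle.coe_one] at h2
    norm_num at h2
  have hcount : ∀ p : Nat.Primes, ∀ w : Circle, ∀ k : ℕ+,
      torusChar (Pi.mulSingle p w) k =
        w ^ Multiset.count p (PNat.factorMultiset k : Multiset Nat.Primes) := by
    intro p w k
    suffices hM : ∀ M : Multiset Nat.Primes,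
        (Multiset.map (Pi.mulSingle p w : InfTorus) M).prod = w ^ Multiset.count p M from
      hM (PNat.factorMultiset k)
    intro M
    rw [Finset.prod_multiset_map_count, Finset.prod_eq_single p]
    · simp
    · intro q _ hq; simp [Pi.mulSingle_eq_of_ne hq]
    · intro hp; simp [Multiset.count_eq_zero.mpr (fun h' => hp (Multiset.mem_toFinset.mpr h'))]
  have hE : PNat.factorMultiset m = PNat.factorMultiset n := by
    refine Multiset.ext.mpr fun p => ?_
    have hp : ∀ w : Circle, w ^ Multiset.count p (PNat.factorMultiset m : Multiset Nat.Primes) =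
        w ^ Multiset.count p (PNat.factorMultiset n : Multiset Nat.Primes) := fun w => by
      rw [← hcount, ← hcount, h]
    rcases le_total (Multiset.count p (PNat.factorMultiset m : Multiset Nat.Primes))
      (Multiset.count p (PNat.factorMultiset n : Multiset Nat.Primes)) with hle | hle
    · obtain ⟨d, hd⟩ := Nat.exists_eq_add_of_le hle
      rw [hd] at hp ⊢
      rw [key _ d fun w => (hp w).symm, add_zero]
    · obtain ⟨d, hd⟩ := Nat.exists_eq_add_of_le hle
      rw [hd] at hp ⊢
      rw [key _ d hp, add_zero]
  exact PNat.factorMultisetEquiv.injective hE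

lemma integral_torusChar (n m : ℕ+) :
    ∫ z, (torusChar z n : ℂ) * (starRingEnd ℂ) (torusChar z m : ℂ) ∂torusMeasure =
      if n = m then 1 else 0 := by
  have hone : ∀ z : InfTorus, ∀ k, (torusChar z k : ℂ) * (starRingEnd ℂ) (torusChar z k : ℂ) = 1 :=
    fun z k => by rw [Complex.mul_conj, Circle.normSq_coe, Complex.ofReal_one]
  split_ifs with h
  · subst h
    simp [hone]
  · obtain ⟨w, hw⟩ : ∃ w, torusChar w n ≠ torusChar w m := by
      by_contra! hc
      exact h (torusChar_injective_of hc)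
    set I := ∫ z, (torusChar z n : ℂ) * (starRingEnd ℂ) (torusChar z m : ℂ) ∂torusMeasure with hI
    have hinv := integral_mul_left_eq_self (μ := torusMeasure)
      (fun z => (torusChar z n : ℂ) * (starRingEnd ℂ) (torusChar z m : ℂ)) w
    have hc : ((torusChar w n : ℂ) * (starRingEnd ℂ) (torusChar w m : ℂ)) * I = I := by
      rw [hI, ← integral_const_mul]
      refine Eq.trans (integral_congr_ae (ae_of_all _ fun z => ?_)) hinv
      simp only [torusChar_mul_left, Circle.coe_mul, map_mul]
      ring
    by_contra hne
    have h1 := mul_eq_right₀ hne |>.mp hc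
    apply hw
    apply Circle.ext
    calc (torusChar w n : ℂ)
        = (torusChar w n : ℂ) * ((torusChar w m : ℂ) * (starRingEnd ℂ) (torusChar w m : ℂ)) := by
          rw [hone, mul_one]
      _ = ((torusChar w n : ℂ) * (starRingEnd ℂ) (torusChar w m : ℂ)) * (torusChar w m : ℂ) := by
          ring
      _ = torusChar w m := by rw [h1, one_mul]

lemma continuous_coe_torusChar (n : ℕ+) : Continuous fun z : InfTorus => (torusChar z n : ℂ) :=
  continuous_subtype_val.comp (continuous_torusChar n)

lemma bohrLift_eq_sum (z : InfTorus) (P : DirichletPoly) :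
    bohrLift z P = ∑ n ∈ P.support, P n * (torusChar z n : ℂ) := by
  simp [bohrLift, Finsupp.linearCombination_apply, Finsupp.sum]

lemma integral_bohrLift_mul (P : DirichletPoly) {φ : InfTorus → ℂ} (hφ : Continuous φ) :
    ∫ z, bohrLift z P * φ z ∂torusMeasure =
      ∑ n ∈ P.support, P n * ∫ z, (torusChar z n : ℂ) * φ z ∂torusMeasure := by
  simp only [bohrLift_eq_sum, Finset.sum_mul, mul_assoc]
  rw [integral_finsetSum]
  · simp only [integral_const_mul]
  · intro n _
    exact (integrable_of_continuous ((continuous_coe_torusChar n).mul hφ)).const_mul _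

lemma integral_norm_bohrLift_le {p : ℝ} (hp : 1 ≤ p) (P : DirichletPoly) :
    ∫ z, ‖bohrLift z P‖ ∂torusMeasure ≤ hardyNorm p P := by
  rw [hardyNorm_eq hp, ← lpNorm_one_eq_integral_norm (continuous_bohrLift P).aestronglyMeasurable,
    ← toReal_eLpNorm (continuous_bohrLift P).aestronglyMeasurable,
    ← toReal_eLpNorm (continuous_bohrLift P).aestronglyMeasurable]
  exact ENNReal.toReal_mono (memLp_bohrLift _ P).eLpNorm_ne_top
    (eLpNorm_le_eLpNorm_of_exponent_le (one_le_ofReal hp)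
      (continuous_bohrLift P).aestronglyMeasurable)

lemma norm_coeff_le_hardyNorm {p : ℝ} (hp : 1 ≤ p) (P : DirichletPoly) (m : ℕ+) :
    ‖P m‖ ≤ hardyNorm p P := by
  have hcont : Continuous fun z : InfTorus => (starRingEnd ℂ) (torusChar z m : ℂ) :=
    Complex.continuous_conj.comp (continuous_coe_torusChar m)
  have h : ∫ z, bohrLift z P * (starRingEnd ℂ) (torusChar z m : ℂ) ∂torusMeasure = P m := by
    rw [integral_bohrLift_mul P hcont]
    simp only [integral_torusChar, mul_ite, mul_one, mul_zero]
    rw [Finset.sum_ite_eq' P.support m (fun n => P n)]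
    split_ifs with hm
    · rfl
    · exact (Finsupp.notMem_support_iff.mp hm).symm
  rw [← h]
  refine (norm_integral_le_integral_norm _).trans ?_
  simp only [norm_mul, Complex.norm_conj, Circle.norm_coe, mul_one]
  exact integral_norm_bohrLift_le hp P

/-- The completely multiplicative function `m ↦ conj χ(m) m^{-s}` (with value `0` at `0`). -/
def kernelTerm (s : ℂ) (z : InfTorus) : ℕ →* ℂ where
  toFun m := if h : 0 < m then
    (starRingEnd ℂ) (torusChar z ⟨m, h⟩ : ℂ) * (m : ℂ) ^ (-s) else 0
  map_one' := by
    have : torusChar z ⟨1, Nat.one_pos⟩ = 1 := map_one (torusChar z)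
    rw [dif_pos Nat.one_pos, this]; simp
  map_mul' m n := by
    rcases Nat.eq_zero_or_pos m with rfl | hm
    · simp
    rcases Nat.eq_zero_or_pos n with rfl | hn
    · simp
    have hmn : 0 < m * n := Nat.mul_pos hm hn
    have : torusChar z ⟨m * n, hmn⟩ = torusChar z ⟨m, hm⟩ * torusChar z ⟨n, hn⟩ :=
      map_mul (torusChar z) (⟨m, hm⟩ : ℕ+) ⟨n, hn⟩
    simp only [hm, hn, hmn, dite_true, this, Circle.coe_mul, map_mul, Nat.cast_mul,
      Complex.natCast_mul_natCast_cpow]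
    ring

lemma kernelTerm_apply (s : ℂ) (z : InfTorus) (m : ℕ+) :
    kernelTerm s z m = (starRingEnd ℂ) (torusChar z m : ℂ) * ((m : ℕ) : ℂ) ^ (-s) := by
  change (if h : 0 < (m : ℕ) then _ else _) = _
  rw [dif_pos m.pos]
  rfl

lemma norm_kernelTerm (s : ℂ) (z : InfTorus) (m : ℕ+) :
    ‖kernelTerm s z m‖ = ((m : ℕ) : ℝ) ^ (-s.re) := by
  rw [kernelTerm_apply, norm_mul, norm_natCast_cpow, Complex.norm_conj, Circle.norm_coe, one_mul,
    Complex.neg_re]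

lemma norm_kernelTerm_prime_lt {s : ℂ} (hs : 0 < s.re) (z : InfTorus) {p : ℕ} (hp : p.Prime) :
    ‖kernelTerm s z p‖ < 1 := by
  have := norm_kernelTerm s z ⟨p, hp.pos⟩
  simp only [PNat.mk_coe] at this
  rw [this]
  exact Real.rpow_lt_one_of_one_lt_of_neg (by exact_mod_cast hp.one_lt) (by linarith)

/-- A Dirichlet polynomial whose support consists of `N`-smooth numbers. -/
def IsSmoothPoly (N : ℕ) (P : DirichletPoly) : Prop :=
  ∀ n ∈ P.support, (n : ℕ) ∈ Nat.smoothNumbers N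

lemma continuous_kernelTerm (s : ℂ) (m : ℕ) : Continuous fun z => kernelTerm s z m := by
  rcases Nat.eq_zero_or_pos m with rfl | hm
  · have : ∀ z, kernelTerm s z 0 = 0 := fun z => rfl
    simp only [this]
    exact continuous_const
  · have : ∀ z, kernelTerm s z m = _ := fun z => kernelTerm_apply s z ⟨m, hm⟩
    simp only [this]
    exact (Complex.continuous_conj.comp (continuous_coe_torusChar _)).mul continuous_const

lemma one_sub_kernelTerm_ne_zero {s : ℂ} (hs : 0 < s.re) (z : InfTorus) {p : ℕ} (hp : p.Prime) :
    1 - kernelTerm s z p ≠ 0 := by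
  intro h
  have h1 : kernelTerm s z p = 1 := (sub_eq_zero.mp h).symm
  have := norm_kernelTerm_prime_lt hs z hp
  rw [h1] at this
  simp at this

lemma continuous_kernel {s : ℂ} (hs : 0 < s.re) (N : ℕ) :
    Continuous fun z => ∏ p ∈ N.primesBelow, (1 - kernelTerm s z p)⁻¹ :=
  continuous_finsetProd _ fun p hp => (continuous_const.sub (continuous_kernelTerm s p)).inv₀
    fun z => one_sub_kernelTerm_ne_zero hs z (Nat.prime_of_mem_primesBelow hp)

lemma integral_kernel {s : ℂ} (hs : 0 < s.re) {N : ℕ} {R : DirichletPoly}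
    (hR : IsSmoothPoly N R) :
    ∫ z, bohrLift z R * ∏ p ∈ N.primesBelow, (1 - kernelTerm s z p)⁻¹ ∂torusMeasure =
      polyEval s R := by
  rw [integral_bohrLift_mul R (continuous_kernel hs N)]
  simp only [polyEval, Finsupp.linearCombination_apply, Finsupp.sum, smul_eq_mul]
  refine Finset.sum_congr rfl fun n hn => ?_
  congr 1
  have hsum := fun z : InfTorus =>
    EulerProduct.summable_and_hasSum_smoothNumbers_prod_primesBelow_geometric
      (f := kernelTerm s z) (fun {p} hp => norm_kernelTerm_prime_lt hs z hp) N
  have hval : ∀ z : InfTorus,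
      (torusChar z n : ℂ) * ∏ p ∈ N.primesBelow, (1 - kernelTerm s z p)⁻¹ =
      ∑' m : N.smoothNumbers, (torusChar z n : ℂ) * kernelTerm s z m := fun z => by
    rw [tsum_mul_left, (hsum z).2.tsum_eq]
  simp only [hval]
  have hnorm : ∀ (z : InfTorus) (m : N.smoothNumbers),
      ‖(torusChar z n : ℂ) * kernelTerm s z m‖ = ‖kernelTerm s 1 m‖ := by
    intro z m
    have hm : 0 < (m : ℕ) := Nat.pos_of_ne_zero (Nat.ne_zero_of_mem_smoothNumbers m.2)
    have h1 := norm_kernelTerm s z ⟨m, hm⟩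
    have h2 := norm_kernelTerm s 1 ⟨m, hm⟩
    rw [norm_mul, Circle.norm_coe, one_mul]
    exact h1.trans h2.symm
  rw [← integral_tsum_of_summable_integral_norm]
  · rw [tsum_eq_single (⟨n, hR n hn⟩ : N.smoothNumbers)]
    · simp only [kernelTerm_apply, ← mul_assoc]
      rw [integral_mul_const, integral_torusChar, if_pos rfl, one_mul]
    · intro m hm
      have hm0 : 0 < (m : ℕ) := Nat.pos_of_ne_zero (Nat.ne_zero_of_mem_smoothNumbers m.2)
      have hk : ∀ z, kernelTerm s z m = _ := fun z => kernelTerm_apply s z ⟨m, hm0⟩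
      simp only [hk, ← mul_assoc]
      have hnm : n ≠ (⟨m, hm0⟩ : ℕ+) := fun h =>
        hm (Subtype.ext (congrArg (fun k : ℕ+ => (k : ℕ)) h).symm)
      have h0 := integral_torusChar n ⟨m, hm0⟩
      rw [if_neg hnm] at h0
      rw [integral_mul_const]
      exact mul_eq_zero_of_left h0 _
  · intro m
    exact integrable_of_continuous
      ((continuous_coe_torusChar n).mul (continuous_kernelTerm s m))
  · simp only [hnorm]
    simpa using (hsum 1).1

lemma exists_mul_factors {s : ℂ} {N : ℕ} {P : DirichletPoly}
    (hP : IsSmoothPoly N P) (S : Finset ℕ) (hS : S ⊆ N.primesBelow) :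
    ∃ R : DirichletPoly, IsSmoothPoly N R ∧
      (∀ z, bohrLift z R = bohrLift z P * ∏ p ∈ S, (1 - (starRingEnd ℂ) (kernelTerm s z p))) ∧
      polyEval s R = polyEval s P * ∏ p ∈ S, (1 - (((p : ℝ) ^ (-(2 * s.re)) : ℝ) : ℂ)) := by
  classical
  induction S using Finset.induction_on with
  | empty => exact ⟨P, hP, by simp, by simp⟩
  | insert p S hpS ih =>
    obtain ⟨R, hR, hB, hE⟩ := ih ((Finset.subset_insert _ _).trans hS)
    have hpN := hS (Finset.mem_insert_self p S)
    have hp : p.Prime := Nat.prime_of_mem_primesBelow hpN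
    set p' : ℕ+ := ⟨p, hp.pos⟩ with hp'
    set c : ℂ := (starRingEnd ℂ) ((p : ℂ) ^ (-s)) with hc
    set R' : DirichletPoly := Finsupp.mapDomain (p' * ·) R with hR'
    have hsm : IsSmoothPoly N R' := by
      intro n hn
      obtain ⟨k, hk, rfl⟩ := Finset.mem_image.mp (Finsupp.mapDomain_support hn)
      exact Nat.mul_mem_smoothNumbers
        (Nat.mem_smoothNumbers_of_lt hp.pos (Nat.lt_of_mem_primesBelow hpN)) (hR k hk)
    have hb : ∀ z, bohrLift z R' = torusChar z p' * bohrLift z R := by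
      intro z
      rw [hR', bohrLift, Finsupp.linearCombination_mapDomain]
      simp only [Finsupp.linearCombination_apply, Finsupp.sum, Function.comp_apply, map_mul,
        Circle.coe_mul, Finset.mul_sum, smul_eq_mul]
      exact Finset.sum_congr rfl fun n _ => by ring
    have he : polyEval s R' = (p : ℂ) ^ (-s) * polyEval s R := by
      rw [hR', polyEval, Finsupp.linearCombination_mapDomain]
      simp only [Finsupp.linearCombination_apply, Finsupp.sum, Function.comp_apply, PNat.mul_coe,
        Nat.cast_mul, Complex.natCast_mul_natCast_cpow, Finset.mul_sum, smul_eq_mul]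
      exact Finset.sum_congr rfl fun n _ => by simp only [hp', PNat.mk_coe]; ring
    refine ⟨R - c • R', ?_, ?_, ?_⟩
    · intro n hn
      rcases Finset.mem_union.mp (Finsupp.support_sub hn) with h | h
      · exact hR n h
      · exact hsm n (Finsupp.support_smul h)
    · intro z
      have hk : kernelTerm s z p = _ := kernelTerm_apply s z p'
      rw [map_sub, map_smul, hb, hB, Finset.prod_insert hpS, hk, smul_eq_mul, map_mul,
        Complex.conj_conj]
      simp only [hp', PNat.mk_coe, hc]
      ring
    · have hcc : c * (p : ℂ) ^ (-s) = (((p : ℝ) ^ (-(2 * s.re)) : ℝ) : ℂ) := by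
        rw [hc, mul_comm, Complex.mul_conj, Complex.normSq_eq_norm_sq,
          Complex.norm_natCast_cpow_of_pos hp.pos, ← Real.rpow_natCast, ← Real.rpow_mul (by positivity)]
        congr 2
        simp
        ring
      rw [map_sub, map_smul, he, hE, Finset.prod_insert hpS, ← hcc, smul_eq_mul]
      ring

/-- The bound `∑ m^{-2σ}` for point evaluations on `Re s = σ`. -/
def evalBound (σ : ℝ) : ℝ := ∑' m : ℕ, (m : ℝ) ^ (-(2 * σ))

lemma evalBound_summable {σ : ℝ} (hσ : 1 / 2 < σ) :
    Summable fun m : ℕ => (m : ℝ) ^ (-(2 * σ)) :=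
  Real.summable_nat_rpow.mpr (by linarith)

lemma evalBound_nonneg (σ : ℝ) : 0 ≤ evalBound σ :=
  tsum_nonneg fun m => Real.rpow_nonneg (Nat.cast_nonneg m) _

lemma evalBound_anti {σ τ : ℝ} (hσ : 1 / 2 < σ) (h : σ ≤ τ) : evalBound τ ≤ evalBound σ := by
  refine Summable.tsum_le_tsum (fun m => ?_) (evalBound_summable (hσ.trans_le h))
    (evalBound_summable hσ)
  rcases Nat.eq_zero_or_pos m with rfl | hm
  · rw [Nat.cast_zero, Real.zero_rpow (by linarith), Real.zero_rpow (by linarith)]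
  · exact Real.rpow_le_rpow_of_exponent_le (by exact_mod_cast hm) (by linarith)

lemma prod_le_evalBound {σ : ℝ} (hσ : 1 / 2 < σ) (N : ℕ) :
    ∏ p ∈ N.primesBelow, (1 - (p : ℝ) ^ (-(2 * σ)))⁻¹ ≤ evalBound σ := by
  let f : ℕ →* ℝ :=
    { toFun := fun m => (m : ℝ) ^ (-(2 * σ))
      map_one' := by simp
      map_mul' := fun m n => by
        rw [Nat.cast_mul, Real.mul_rpow (Nat.cast_nonneg m) (Nat.cast_nonneg n)] }
  have h := EulerProduct.summable_and_hasSum_smoothNumbers_prod_primesBelow_geometric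
    (f := f) (fun {p} hp => by
      change ‖(p : ℝ) ^ (-(2 * σ))‖ < 1
      rw [Real.norm_of_nonneg (Real.rpow_nonneg (Nat.cast_nonneg p) _)]
      exact Real.rpow_lt_one_of_one_lt_of_neg (by exact_mod_cast hp.one_lt) (by linarith)) N
  change ∏ p ∈ N.primesBelow, (1 - f p)⁻¹ ≤ _
  rw [← h.2.tsum_eq]
  exact Summable.tsum_subtype_le (fun m : ℕ => (m : ℝ) ^ (-(2 * σ))) _
    (fun m => Real.rpow_nonneg (Nat.cast_nonneg m) _) (evalBound_summable hσ)

lemma norm_polyEval_le {p : ℝ} (hp : 1 ≤ p) {s : ℂ} (hs : 1 / 2 < s.re) (P : DirichletPoly) :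
    ‖polyEval s P‖ ≤ evalBound s.re * hardyNorm p P := by
  have hs0 : 0 < s.re := by linarith
  obtain ⟨N, hN⟩ : ∃ N : ℕ, ∀ n ∈ P.support, (n : ℕ) < N :=
    ⟨P.support.sup (fun n : ℕ+ => (n : ℕ)) + 1, fun n hn =>
      Nat.lt_succ_of_le (Finset.le_sup (f := fun n : ℕ+ => (n : ℕ)) hn)⟩
  have hP : IsSmoothPoly N P := fun n hn => Nat.mem_smoothNumbers_of_lt n.pos (hN n hn)
  obtain ⟨R, hR, hB, hE⟩ := exists_mul_factors (s := s) hP N.primesBelow subset_rfl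
  have hint := integral_kernel hs0 hR
  set c : ℝ := ∏ p ∈ N.primesBelow, (1 - (p : ℝ) ^ (-(2 * s.re))) with hc
  have hcpos : 0 < c := Finset.prod_pos fun p hp' => by
    have : (p : ℝ) ^ (-(2 * s.re)) < 1 := Real.rpow_lt_one_of_one_lt_of_neg
      (by exact_mod_cast (Nat.prime_of_mem_primesBelow hp').one_lt) (by linarith)
    linarith
  have hcinv : c⁻¹ ≤ evalBound s.re := by
    rw [hc, ← Finset.prod_inv_distrib]
    exact prod_le_evalBound hs N
  have hEc : polyEval s R = polyEval s P * (c : ℂ) := by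
    rw [hE, hc]; push_cast; rfl
  have hnorm : ∀ z, ‖bohrLift z R * ∏ p ∈ N.primesBelow, (1 - kernelTerm s z p)⁻¹‖ =
      ‖bohrLift z P‖ := by
    intro z
    rw [hB, mul_assoc, ← Finset.prod_mul_distrib, norm_mul, norm_prod, Finset.prod_eq_one, mul_one]
    intro p hp'
    have hne := one_sub_kernelTerm_ne_zero hs0 z (Nat.prime_of_mem_primesBelow hp')
    have hconj : 1 - (starRingEnd ℂ) (kernelTerm s z p) =
        (starRingEnd ℂ) (1 - kernelTerm s z p) := by simp
    rw [norm_mul, hconj, Complex.norm_conj, norm_inv, mul_inv_cancel₀ (norm_ne_zero_iff.mpr hne)]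
  have hmain : ‖polyEval s P‖ * c ≤ hardyNorm p P := by
    calc ‖polyEval s P‖ * c = ‖polyEval s R‖ := by
          rw [hEc, norm_mul, Complex.norm_real, Real.norm_of_nonneg hcpos.le]
      _ ≤ ∫ z, ‖bohrLift z P‖ ∂torusMeasure := by
          rw [← hint]
          refine (norm_integral_le_integral_norm _).trans (le_of_eq ?_)
          simp only [hnorm]
      _ ≤ hardyNorm p P := integral_norm_bohrLift_le hp P
  calc ‖polyEval s P‖ = c⁻¹ * (‖polyEval s P‖ * c) := by field_simp
    _ ≤ evalBound s.re * hardyNorm p P :=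
      mul_le_mul hcinv hmain (by positivity) (evalBound_nonneg _)

/-- A quantity dominated by `‖P_σ‖_{𝓗^q}` for small `σ` is dominated by `‖P‖_{𝓐^q_α}`. -/
lemma exists_bound_bergman {q α : ℝ} (hq : 1 ≤ q) (hα : -1 < α) {δ M : ℝ} (hδ : 0 < δ)
    (hM : 0 ≤ M) : ∃ C : ℝ, ∀ (P : DirichletPoly) (c : ℝ), 0 ≤ c →
      (∀ σ ∈ Set.Ioo 0 δ, c ≤ M * hardyNorm q (translate σ P)) →
      c ≤ C * bergmanNorm q α P := by
  have := isProbabilityMeasure_bergmanMeasure hα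
  have hq0 : 0 < q := by linarith
  set μ := bergmanMeasure α with hμ
  set v : ℝ := μ.real (Set.Ioo 0 δ) with hv
  have hvpos : 0 < v := by
    refine ENNReal.toReal_pos ?_ (measure_ne_top _ _)
    intro h0
    rw [hμ, bergmanMeasure, ProbabilityTheory.gammaMeasure,
      withDensity_apply_eq_zero (by unfold ProbabilityTheory.gammaPDF; fun_prop)] at h0
    have hsub : Set.Ioo 0 δ ⊆
        {x | ProbabilityTheory.gammaPDF (α + 1) 2 x ≠ 0} ∩ Set.Ioo 0 δ := fun x hx =>
      ⟨by
        have := ProbabilityTheory.gammaPDFReal_pos (a := α + 1) (r := 2) (by linarith)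
          (by norm_num) hx.1
        simpa [ProbabilityTheory.gammaPDF] using this, hx⟩
    have := measure_mono_null hsub h0
    simp [hδ.not_ge] at this
  refine ⟨v ^ (-(1 / q)) * M, fun P c hc h => ?_⟩
  set g : ℝ → ℝ := fun σ => (M * hardyNorm q (translate σ P)) ^ q with hg
  have hMP := memLp_hardyNorm_translate hq hα P (ENNReal.ofReal q)
  have hgint : Integrable g μ := by
    have h1 := (hMP.const_mul M).integrable_norm_rpow (by simp; linarith) (by simp)
    rw [ENNReal.toReal_ofReal hq0.le] at h1
    refine h1.congr (ae_of_all _ fun σ => ?_)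
    simp only [hg, Real.norm_of_nonneg (mul_nonneg hM (hardyNorm_nonneg q (translate σ P)))]
  have hgnn : ∀ σ, 0 ≤ g σ := fun σ =>
    Real.rpow_nonneg (mul_nonneg hM (hardyNorm_nonneg _ _)) _
  have h1 : c ^ q * v ≤ ∫ σ, g σ ∂μ := by
    calc c ^ q * v = ∫ _ in Set.Ioo 0 δ, c ^ q ∂μ := by
          rw [setIntegral_const, smul_eq_mul, mul_comm]
      _ ≤ ∫ σ in Set.Ioo 0 δ, g σ ∂μ :=
          setIntegral_mono_on (integrable_const _).integrableOn hgint.integrableOn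
            measurableSet_Ioo fun σ hσ => Real.rpow_le_rpow hc (h σ hσ) hq0.le
      _ ≤ ∫ σ, g σ ∂μ := setIntegral_le_integral hgint (ae_of_all _ hgnn)
  have h2 : ∫ σ, g σ ∂μ = M ^ q * ∫ σ, hardyNorm q (translate σ P) ^ q ∂μ := by
    rw [← integral_const_mul]
    congr 1
    ext σ
    exact Real.mul_rpow hM (hardyNorm_nonneg _ _)
  set J := ∫ σ, hardyNorm q (translate σ P) ^ q ∂μ with hJ
  have hJ0 : 0 ≤ J := integral_nonneg fun σ => Real.rpow_nonneg (hardyNorm_nonneg _ _) _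
  have h3 := Real.rpow_le_rpow (by positivity) (h1.trans_eq h2) (by positivity : 0 ≤ 1 / q)
  rw [Real.mul_rpow (by positivity) hvpos.le, Real.mul_rpow (by positivity) hJ0,
    ← Real.rpow_mul hc, ← Real.rpow_mul hM, mul_one_div_cancel hq0.ne', Real.rpow_one,
    Real.rpow_one] at h3
  have hv' : 0 < v ^ (1 / q) := Real.rpow_pos_of_pos hvpos _
  rw [Real.rpow_neg hvpos.le, mul_assoc, inv_mul_eq_div, le_div_iff₀ hv']
  exact h3

lemma exists_norm_polyEval_le_bergman {q α : ℝ} (hq : 1 ≤ q) (hα : -1 < α) {s : ℂ}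
    (hs : 1 / 2 < s.re) : ∃ C, ∀ P : DirichletPoly, ‖polyEval s P‖ ≤ C * bergmanNorm q α P := by
  set δ := (s.re - 1 / 2) / 2 with hδ
  have hδ0 : 0 < δ := by rw [hδ]; linarith
  have hδs : 1 / 2 < s.re - δ := by rw [hδ]; linarith
  obtain ⟨C, hC⟩ := exists_bound_bergman hq hα hδ0 (evalBound_nonneg (s.re - δ))
  refine ⟨C, fun P => hC P _ (norm_nonneg _) fun σ hσ => ?_⟩
  have h1 : polyEval s P = polyEval (s - σ) (translate σ P) := by
    rw [polyEval_translate]; congr 1; ring_nf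
  have hre : (s - σ).re = s.re - σ := by simp
  rw [h1]
  refine (norm_polyEval_le hq (by rw [hre]; linarith [hσ.2]) _).trans ?_
  refine mul_le_mul_of_nonneg_right ?_ (hardyNorm_nonneg _ _)
  rw [hre]
  exact evalBound_anti hδs (by linarith [hσ.2])

lemma exists_norm_coeff_le_bergman {q α : ℝ} (hq : 1 ≤ q) (hα : -1 < α) (n : ℕ+) :
    ∃ C, ∀ P : DirichletPoly, ‖P n‖ ≤ C * bergmanNorm q α P := by
  obtain ⟨C, hC⟩ := exists_bound_bergman hq hα one_pos (Nat.cast_nonneg (n : ℕ) : (0 : ℝ) ≤ _)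
  refine ⟨C, fun P => hC P _ (norm_nonneg _) fun σ hσ => ?_⟩
  have hn : (1 : ℝ) ≤ (n : ℕ) := by exact_mod_cast n.pos
  have h1 := norm_coeff_le_hardyNorm hq (translate σ P) n
  rw [translate_apply, norm_mul, norm_natCast_cpow] at h1
  have h2 : ((n : ℕ) : ℝ)⁻¹ ≤ ((n : ℕ) : ℝ) ^ (-(σ : ℂ)).re := by
    rw [← Real.rpow_neg_one]
    exact Real.rpow_le_rpow_of_exponent_le hn (by simpa using hσ.2.le)
  have h3 : ‖P n‖ * ((n : ℕ) : ℝ)⁻¹ ≤ hardyNorm q (translate σ P) :=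
    (mul_le_mul_of_nonneg_left h2 (norm_nonneg _)).trans h1
  rwa [← div_eq_mul_inv, div_le_iff₀' (by linarith)] at h3

/-! ### The Banach spaces of Dirichlet series -/

/-- The space of Dirichlet polynomials, endowed with the seminorm `N`. -/
def NormedPoly (_N : Seminorm ℂ DirichletPoly) : Type := DirichletPoly

instance (N : Seminorm ℂ DirichletPoly) : AddCommGroup (NormedPoly N) :=
  inferInstanceAs (AddCommGroup DirichletPoly)

instance (N : Seminorm ℂ DirichletPoly) : Module ℂ (NormedPoly N) :=
  inferInstanceAs (Module ℂ DirichletPoly)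

instance (N : Seminorm ℂ DirichletPoly) : SeminormedAddCommGroup (NormedPoly N) :=
  AddGroupSeminorm.toSeminormedAddCommGroup (E := NormedPoly N) N.toAddGroupSeminorm

instance (N : Seminorm ℂ DirichletPoly) : NormedSpace ℂ (NormedPoly N) where
  norm_smul_le c P := (map_smul_eq_mul N c P).le

/-- The underlying Dirichlet polynomial. -/
def NormedPoly.toPoly {N : Seminorm ℂ DirichletPoly} : NormedPoly N →ₗ[ℂ] DirichletPoly :=
  LinearMap.id (M := DirichletPoly)

/-- The Banach space obtained by completing the Dirichlet polynomials for `N`. -/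
abbrev SeriesSpace (N : Seminorm ℂ DirichletPoly) : Type :=
  UniformSpace.Completion (NormedPoly N)

/-- A Dirichlet polynomial as an element of the completion. -/
def SeriesSpace.ofPoly (N : Seminorm ℂ DirichletPoly) (P : DirichletPoly) : SeriesSpace N :=
  let P' : NormedPoly N := P
  (P' : UniformSpace.Completion (NormedPoly N))

/-- The `n`-th Dirichlet coefficient of an element of the completion: the continuous extension of
`P ↦ aₙ(P)`. For the two families of spaces used below this functional is uniformly continuous on
Dirichlet polynomials, by `hardy_coeff_uniformContinuous` and `bergman_coeff_uniformContinuous`. -/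
def SeriesSpace.coeff {N : Seminorm ℂ DirichletPoly} (f : SeriesSpace N) (n : ℕ+) : ℂ :=
  UniformSpace.Completion.extension (fun P : NormedPoly N => P.toPoly n) f

/-- The value `f(s)`, `Re s > 1/2`, of an element `f` of the completion: the continuous extension
of the point evaluation `P ↦ P(s)`. For the two families of spaces used below the point evaluation
is uniformly continuous on Dirichlet polynomials when `Re s > 1/2`, by
`hardy_eval_uniformContinuous` and `bergman_eval_uniformContinuous`. -/
def SeriesSpace.eval {N : Seminorm ℂ DirichletPoly} (f : SeriesSpace N) (s : ℂ) : ℂ :=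
  UniformSpace.Completion.extension (fun P : NormedPoly N => polyEval s P.toPoly) f

/-- The Hardy space `𝓗^p` of Dirichlet series. -/
abbrev HardySpace (p : ℝ) (hp : 1 ≤ p) : Type := SeriesSpace (hardySeminorm p hp)

/-- The Bergman space `𝓐^q_α` of Dirichlet series. -/
abbrev BergmanSpace (q α : ℝ) (hq : 1 ≤ q) (hα : -1 < α) : Type :=
  SeriesSpace (bergmanSeminorm q α hq hα)

lemma SeriesSpace.norm_ofPoly (N : Seminorm ℂ DirichletPoly) (P : DirichletPoly) :
    ‖SeriesSpace.ofPoly N P‖ = N P :=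
  UniformSpace.Completion.norm_coe (E := NormedPoly N) (show NormedPoly N from P)

lemma uniformContinuous_of_bound {N : Seminorm ℂ DirichletPoly} (L : DirichletPoly →ₗ[ℂ] ℂ)
    (h : ∃ C, ∀ P, ‖L P‖ ≤ C * N P) :
    UniformContinuous fun P : NormedPoly N => L P.toPoly := by
  obtain ⟨C, hC⟩ := h
  exact ((L.comp NormedPoly.toPoly).mkContinuous C fun P => hC P.toPoly).uniformContinuous

lemma hardy_coeff_uniformContinuous {p : ℝ} (hp : 1 ≤ p) (n : ℕ+) :
    UniformContinuous fun P : NormedPoly (hardySeminorm p hp) => P.toPoly n :=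
  uniformContinuous_of_bound (Finsupp.lapply n)
    ⟨1, fun P => (norm_coeff_le_hardyNorm hp P n).trans (one_mul _).ge⟩

lemma hardy_eval_uniformContinuous {p : ℝ} (hp : 1 ≤ p) {s : ℂ} (hs : 1 / 2 < s.re) :
    UniformContinuous fun P : NormedPoly (hardySeminorm p hp) => polyEval s P.toPoly :=
  uniformContinuous_of_bound (polyEval s) ⟨_, fun P => norm_polyEval_le hp hs P⟩

lemma bergman_coeff_uniformContinuous {q α : ℝ} (hq : 1 ≤ q) (hα : -1 < α) (n : ℕ+) :
    UniformContinuous fun P : NormedPoly (bergmanSeminorm q α hq hα) => P.toPoly n :=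
  uniformContinuous_of_bound (Finsupp.lapply n) (exists_norm_coeff_le_bergman hq hα n)

lemma bergman_eval_uniformContinuous {q α : ℝ} (hq : 1 ≤ q) (hα : -1 < α) {s : ℂ}
    (hs : 1 / 2 < s.re) : UniformContinuous
      fun P : NormedPoly (bergmanSeminorm q α hq hα) => polyEval s P.toPoly :=
  uniformContinuous_of_bound (polyEval s) (exists_norm_polyEval_le_bergman hq hα hs)

lemma hardy_eval_ofPoly {p : ℝ} (hp : 1 ≤ p) {s : ℂ} (hs : 1 / 2 < s.re) (P : DirichletPoly) :
    (SeriesSpace.ofPoly (hardySeminorm p hp) P).eval s = polyEval s P :=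
  UniformSpace.Completion.extension_coe (hardy_eval_uniformContinuous hp hs) (show NormedPoly _ from P)

lemma hardy_coeff_ofPoly {p : ℝ} (hp : 1 ≤ p) (n : ℕ+) (P : DirichletPoly) :
    (SeriesSpace.ofPoly (hardySeminorm p hp) P).coeff n = P n :=
  UniformSpace.Completion.extension_coe (hardy_coeff_uniformContinuous hp n) (show NormedPoly _ from P)

lemma bergman_eval_ofPoly {q α : ℝ} (hq : 1 ≤ q) (hα : -1 < α) {s : ℂ} (hs : 1 / 2 < s.re)
    (P : DirichletPoly) :
    (SeriesSpace.ofPoly (bergmanSeminorm q α hq hα) P).eval s = polyEval s P :=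
  UniformSpace.Completion.extension_coe (bergman_eval_uniformContinuous hq hα hs) (show NormedPoly _ from P)

/-! ### The operators -/

/-- The Riemann–Liouville operator
`I_t F(s) = 1/Γ(t) ∫_s^∞ (u - s)^{t-1} F(u) du = 1/Γ(t) ∫_0^∞ x^{t-1} F(x + s) dx`. -/
def riemannLiouville (t : ℝ) (F : ℂ → ℂ) (s : ℂ) : ℂ :=
  (1 / Real.Gamma t : ℝ) * ∫ x in Set.Ioi (0 : ℝ), ((x ^ (t - 1) : ℝ) : ℂ) * F (x + s)

/-- The integral that defines `I_t F(s)` is absolutely convergent. -/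
def RiemannLiouvilleConverges (t : ℝ) (F : ℂ → ℂ) (s : ℂ) : Prop :=
  IntegrableOn (fun x : ℝ => ((x ^ (t - 1) : ℝ) : ℂ) * F (x + s)) (Set.Ioi 0)

/-- For `t = 1` the operator is the classical integration `F ↦ ∫_s^∞ F(u) du`. -/
lemma riemannLiouville_one (F : ℂ → ℂ) (s : ℂ) :
    riemannLiouville 1 F s = ∫ x in Set.Ioi (0 : ℝ), F (x + s) := by
  simp [riemannLiouville]

/-- `I_t : 𝓗^p → 𝓐^q_α` is bounded. The operator acts on the Dirichlet series without constant
term: every such `f ∈ 𝓗^p` has `I_t f ∈ 𝓐^q_α` with `‖I_t f‖ ≤ C ‖f‖`. -/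
def RiemannLiouvilleBounded (t p q α : ℝ) (hp : 1 ≤ p) (hq : 1 ≤ q) (hα : -1 < α) : Prop :=
  ∃ C : ℝ, ∀ f : HardySpace p hp, f.coeff 1 = 0 →
    ∃ g : BergmanSpace q α hq hα, ‖g‖ ≤ C * ‖f‖ ∧
      ∀ s : ℂ, 1 / 2 < s.re →
        RiemannLiouvilleConverges t f.eval s ∧ g.eval s = riemannLiouville t f.eval s

/-- The identity `𝓗^p → 𝓐^q_β` is bounded: every `f ∈ 𝓗^p`, as a function on `Re s > 1/2`,
belongs to `𝓐^q_β` with `‖f‖_{𝓐^q_β} ≤ C ‖f‖_{𝓗^p}`. -/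
def InclusionBounded (p q β : ℝ) (hp : 1 ≤ p) (hq : 1 ≤ q) (hβ : -1 < β) : Prop :=
  ∃ C : ℝ, ∀ f : HardySpace p hp,
    ∃ g : BergmanSpace q β hq hβ, ‖g‖ ≤ C * ‖f‖ ∧
      ∀ s : ℂ, 1 / 2 < s.re → g.eval s = f.eval s

lemma neg_one_lt_add_mul {α q t : ℝ} (hα : -1 < α) (hq : 1 ≤ q) (ht : 0 < t) :
    -1 < α + q * t := by
  have : 0 < q * t := mul_pos (by linarith) ht
  linarith

end

end DirichletSpaces

/-! Conditions 1 and 2 are each shown equivalent to `q ≤ p`; the weight only matters through its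
exponent exceeding `-1`.

Sufficiency. On the torus, a probability space, `q ≤ p` gives `‖P‖_{𝓗^q} ≤ ‖P‖_{𝓗^p}`. Horizontal
translations contract `𝓗^q` and `μ_α` has mass one, so the Bergman norm is at most the `𝓗^q` norm
(`bergmanNorm_le_hardyNorm`). If `a₁ = 0`, the translates decay like `2^{-x}`, so the integral
defining `I_t` converges in `𝓗^q` with norm at most `(log 2)^{-t}` (`hardyNorm_fracInt_le`). Both
operators are thus bounded on polynomials and extend by density.

Necessity. On polynomials of length `M` every norm in sight is comparable up to powers of `log M`,
except `𝓗^p` with `𝓗^q`. Translation by `1 / log M` costs a factor `e`, and `μ_α(0, 1 / log M)` is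
at least a multiple of `(log M)^{-(α+1)}`, so the `𝓗^q` norm is at most a power of `log M` times the
Bergman norm (`exists_hardyNorm_le_log_rpow_mul`). By Bernstein's inequality, undoing `I_t` costs a
power of `log M` as well (`exists_fracInt_eq`). Either boundedness property would therefore give
`‖F‖_{𝓗^q} ≤ K (log M)^b ‖F‖_{𝓗^p}`. For `p < q` this fails for the product of `1 + z_j` over `N`
primes: the ratio of its norms is exponential in `N`, because `‖1 + z‖_{L^p}` increases strictly
with `p`, while `log M` can be kept below `N²` (`not_hardyNorm_le_log_pow_mul`).

Two tools support this. Vertical translations are rotations of the torus, hence isometries, so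
Phragmén–Lindelöf, Cauchy's estimate and the three lines theorem apply to the `L^q`-valued function
`w ↦ P(w + ·)`. Moreover an element of the completed Bergman space that agrees with a polynomial `Q`
on `Re s > 1/2` must obey the lower bound expected from `Q` (`measure_rpow_mul_hardyNorm_le_norm`);
this uniqueness statement needs its own argument because the spaces are abstract completions. -/

namespace DirichletSpaces

/-! ### Exponential sums in a half-plane -/

section ExpSum

variable {E ι : Type*} [NormedAddCommGroup E] [NormedSpace ℂ E]

lemma differentiable_expSum (S : Finset ι) (l : ι → ℝ) (v : ι → E) :
    Differentiable ℂ fun w : ℂ => ∑ i ∈ S, Complex.exp (-(l i * w)) • v i := by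
  fun_prop

lemma norm_expSum_le (S : Finset ι) (l : ι → ℝ) (v : ι → E) (w : ℂ) :
    ‖∑ i ∈ S, Complex.exp (-(l i * w)) • v i‖ ≤ ∑ i ∈ S, Real.exp (-(l i * w.re)) * ‖v i‖ := by
  refine (norm_sum_le _ _).trans (Finset.sum_le_sum fun i _ => ?_)
  rw [norm_smul, Complex.norm_exp]
  simp

/-- Phragmén–Lindelöf for exponential sums with nonnegative frequencies. -/
lemma norm_expSum_le_of_imaginary_axis (S : Finset ι) (l : ι → ℝ) (v : ι → E) {B : ℝ}
    (hl : ∀ i ∈ S, 0 ≤ l i)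
    (hB : ∀ τ : ℝ, ‖∑ i ∈ S, Complex.exp (-(l i * (τ * Complex.I))) • v i‖ ≤ B)
    {w : ℂ} (hw : 0 ≤ w.re) : ‖∑ i ∈ S, Complex.exp (-(l i * w)) • v i‖ ≤ B := by
  have hbdd : ∀ z : ℂ, 0 ≤ z.re →
      ‖∑ i ∈ S, Complex.exp (-(l i * z)) • v i‖ ≤ ∑ i ∈ S, ‖v i‖ := fun z hz => by
    refine (norm_expSum_le S l v z).trans (Finset.sum_le_sum fun i hi => ?_)
    refine mul_le_of_le_one_left (norm_nonneg _) (Real.exp_le_one_iff.mpr ?_)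
    have := mul_nonneg (hl i hi) hz
    linarith
  refine PhragmenLindelof.right_half_plane_of_bounded_on_real
    (f := fun w => ∑ i ∈ S, Complex.exp (-(l i * w)) • v i)
    -- Exponent `1 < 2` and factor `0`: the growth condition reduces to boundedness on the
    -- half-plane, which `hbdd` provides.
    (differentiable_expSum S l v).diffContOnCl ⟨1, by norm_num, 0, ?_⟩ ?_ hB hw
  · refine Asymptotics.IsBigO.of_bound (∑ i ∈ S, ‖v i‖) ?_
    filter_upwards [mem_inf_of_right (mem_principal_self _)] with z hz
    simpa using hbdd z (le_of_lt hz)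
  · refine isBoundedUnder_of_eventually_le (a := ∑ i ∈ S, ‖v i‖) ?_
    filter_upwards [eventually_ge_atTop 0] with x hx
    exact hbdd x (by simpa using hx)

end ExpSum

/-! ### Coefficient multipliers -/

/-- The operator that multiplies the `n`-th coefficient by `c n`. -/
noncomputable def multiplier (c : ℕ+ → ℂ) : DirichletPoly →ₗ[ℂ] DirichletPoly :=
  Finsupp.linearCombination ℂ fun n : ℕ+ => Finsupp.single n (c n)

lemma multiplier_apply (c : ℕ+ → ℂ) (P : DirichletPoly) (n : ℕ+) :
    multiplier c P n = P n * c n := by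
  have h : (Finsupp.lapply n).comp (multiplier c) =
      c n • (Finsupp.lapply n : DirichletPoly →ₗ[ℂ] ℂ) := by
    refine Finsupp.lhom_ext fun m a => ?_
    by_cases hm : m = n
    · subst hm; simp [multiplier, mul_comm]
    · simp [multiplier, hm]
  have := LinearMap.congr_fun h P
  simpa [mul_comm] using this

lemma support_multiplier_subset (c : ℕ+ → ℂ) (P : DirichletPoly) :
    (multiplier c P).support ⊆ P.support := fun n hn => by
  rw [Finsupp.mem_support_iff, multiplier_apply] at hn
  exact Finsupp.mem_support_iff.mpr (left_ne_zero_of_mul hn)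

lemma multiplier_multiplier (c d : ℕ+ → ℂ) (P : DirichletPoly) :
    multiplier c (multiplier d P) = multiplier (fun n => d n * c n) P := by
  ext n
  simp only [multiplier_apply, mul_assoc]

lemma multiplier_congr {c d : ℕ+ → ℂ} {P : DirichletPoly} (h : ∀ n ∈ P.support, c n = d n) :
    multiplier c P = multiplier d P := by
  ext n
  rw [multiplier_apply, multiplier_apply]
  by_cases hn : n ∈ P.support
  · rw [h n hn]
  · rw [Finsupp.notMem_support_iff.mp hn, zero_mul, zero_mul]

/-- The translation by a complex number: the `n`-th coefficient is multiplied by `n^{-w}`. -/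
noncomputable def shift (w : ℂ) : DirichletPoly →ₗ[ℂ] DirichletPoly :=
  multiplier fun n => ((n : ℕ) : ℂ) ^ (-w)

lemma translate_eq_shift (σ : ℝ) : translate σ = shift σ := by
  refine LinearMap.ext fun P => Finsupp.ext fun n => ?_
  rw [translate_apply, shift, multiplier_apply]

lemma natCast_cpow_neg_eq_exp (n : ℕ+) (w : ℂ) :
    ((n : ℕ) : ℂ) ^ (-w) = Complex.exp (-((Real.log (n : ℕ) : ℝ) * w)) := by
  rw [Complex.cpow_def_of_ne_zero (by exact_mod_cast n.ne_zero), Complex.natCast_log, mul_neg]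

lemma shift_shift (w v : ℂ) (P : DirichletPoly) : shift w (shift v P) = shift (v + w) P := by
  rw [shift, shift, multiplier_multiplier, shift]
  congr 2
  ext n
  rw [neg_add, Complex.cpow_add _ _ (by exact_mod_cast n.ne_zero)]

lemma shift_zero (P : DirichletPoly) : shift 0 P = P := by
  ext n
  rw [shift, multiplier_apply, neg_zero, Complex.cpow_zero, mul_one]

/-! ### Dirichlet polynomials as elements of `L^q` of the torus -/

/-- The Bohr lift as an element of `L^q`. -/
noncomputable def bohrLp (q : ℝ) : DirichletPoly →ₗ[ℂ] Lp ℂ (ENNReal.ofReal q) torusMeasure where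
  toFun P := (memLp_bohrLift (ENNReal.ofReal q) P).toLp _
  map_add' P Q := by
    rw [← MemLp.toLp_add]
    congr 1
    ext z
    exact map_add (bohrLift z) P Q
  map_smul' c P := by
    rw [RingHom.id_apply, ← MemLp.toLp_const_smul]
    congr 1
    ext z
    exact map_smul (bohrLift z) c P

lemma norm_bohrLp {q : ℝ} (hq : 1 ≤ q) (P : DirichletPoly) : ‖bohrLp q P‖ = hardyNorm q P := by
  rw [hardyNorm_eq hq, ← toReal_eLpNorm (continuous_bohrLift P).aestronglyMeasurable]
  exact Lp.norm_toLp _ (memLp_bohrLift _ P)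

lemma bohrLp_multiplier (q : ℝ) (c : ℕ+ → ℂ) (P : DirichletPoly) :
    bohrLp q (multiplier c P) = ∑ n ∈ P.support, c n • bohrLp q (Finsupp.single n (P n)) := by
  conv_lhs => rw [← Finsupp.sum_single P]
  simp only [Finsupp.sum, map_sum]
  refine Finset.sum_congr rfl fun n _ => ?_
  rw [← map_smul]
  congr 1
  ext m
  rw [multiplier_apply]
  by_cases h : n = m
  · subst h; simp [mul_comm]
  · simp [h]

/-- An `L^q`-valued exponential sum with frequencies `log n`, entire in `w`: the form to which the
theorems of complex analysis are applied. -/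
lemma bohrLp_shift (q : ℝ) (w : ℂ) (P : DirichletPoly) :
    bohrLp q (shift w P) = ∑ n ∈ P.support,
      Complex.exp (-((Real.log (n : ℕ) : ℝ) * w)) • bohrLp q (Finsupp.single n (P n)) := by
  rw [shift, bohrLp_multiplier]
  simp only [natCast_cpow_neg_eq_exp]

/-- The point `(p^{-iτ})_p` of the torus. -/
noncomputable def verticalFlow (τ : ℝ) : InfTorus := fun p => Circle.exp (-(τ * Real.log (p : ℕ)))

lemma torusChar_verticalFlow (τ : ℝ) (n : ℕ+) :
    torusChar (verticalFlow τ) n = Circle.exp (-(τ * Real.log (n : ℕ))) := by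
  have h : ∀ M : PrimeMultiset,
      (Multiset.map (verticalFlow τ) (M : Multiset Nat.Primes)).prod =
        Circle.exp (-(τ * Real.log (M.prod : ℕ))) := by
    intro M
    induction M using Multiset.induction_on with
    | empty =>
      change (1 : Circle) = Circle.exp (-(τ * Real.log ((1 : ℕ+) : ℕ)))
      simp
    | cons p M ih =>
      have h1 : PrimeMultiset.prod (p ::ₘ M : Multiset Nat.Primes) =
          (p : ℕ+) * PrimeMultiset.prod M := by
        rw [← Multiset.singleton_add]
        exact (PrimeMultiset.prod_add (PrimeMultiset.ofPrime p) M).trans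
          (by rw [PrimeMultiset.prod_ofPrime])
      refine (congrArg Multiset.prod (Multiset.map_cons (verticalFlow τ) p M)).trans ?_
      refine (Multiset.prod_cons _ _).trans ?_
      rw [ih, h1, PNat.mul_coe, Nat.cast_mul, Real.log_mul (by simp)
        (by simp), verticalFlow, ← Circle.exp_add]
      congr 1
      change -(τ * Real.log (p : ℕ)) + _ = -(τ * (Real.log (p : ℕ) + _))
      ring
  have := h (PNat.factorMultiset n)
  rwa [PNat.prod_factorMultiset] at this

lemma bohrLift_multiplier (z : InfTorus) (c : ℕ+ → ℂ) (P : DirichletPoly) :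
    bohrLift z (multiplier c P) = ∑ n ∈ P.support, P n * c n * (torusChar z n : ℂ) := by
  rw [bohrLift, Finsupp.linearCombination_apply,
    Finsupp.sum_of_support_subset _ (support_multiplier_subset c P) _ (by simp)]
  simp [multiplier_apply]

/-- The character at the flow point is `n ↦ n^{-iτ}`, so a vertical translation becomes a rotation
of the torus; invariance of Haar measure then makes it an isometry. -/
lemma bohrLift_shift_I (τ : ℝ) (z : InfTorus) (P : DirichletPoly) :
    bohrLift z (shift (τ * Complex.I) P) = bohrLift (verticalFlow τ * z) P := by
  rw [shift, bohrLift_multiplier, bohrLift_eq_sum]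
  refine Finset.sum_congr rfl fun n _ => ?_
  rw [torusChar_mul_left, torusChar_verticalFlow, Circle.coe_mul, Circle.coe_exp,
    natCast_cpow_neg_eq_exp, mul_assoc]
  congr 3
  push_cast
  ring

/-- Vertical translations are isometries. -/
lemma hardyNorm_shift_I (q τ : ℝ) (P : DirichletPoly) :
    hardyNorm q (shift (τ * Complex.I) P) = hardyNorm q P := by
  simp only [hardyNorm, bohrLift_shift_I]
  rw [integral_mul_left_eq_self (fun z => ‖bohrLift z P‖ ^ q) (verticalFlow τ)]

/-- Decay of horizontal translates. -/
lemma hardyNorm_shift_le {q : ℝ} (hq : 1 ≤ q) {a : ℝ} (ha : 0 < a) {P : DirichletPoly}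
    (hP : ∀ n ∈ P.support, a ≤ (n : ℕ)) {w : ℂ} (hw : 0 ≤ w.re) :
    hardyNorm q (shift w P) ≤ a ^ (-w.re) * hardyNorm q P := by
  have : Fact (1 ≤ ENNReal.ofReal q) := ⟨one_le_ofReal hq⟩
  -- The factor `a^z` has modulus one on the imaginary axis and lowers the frequencies to `log n -
  -- log a ≥ 0`.
  have key : ∀ z : ℂ, ∑ n ∈ P.support, Complex.exp (-(((Real.log (n : ℕ) - Real.log a : ℝ) : ℂ) * z))
      • bohrLp q (Finsupp.single n (P n)) =
      Complex.exp ((Real.log a : ℝ) * z) • bohrLp q (shift z P) := fun z => by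
    rw [bohrLp_shift, Finset.smul_sum]
    refine Finset.sum_congr rfl fun n _ => ?_
    rw [smul_smul, ← Complex.exp_add]
    congr 2
    push_cast
    ring
  have h := norm_expSum_le_of_imaginary_axis P.support
    (fun n : ℕ+ => Real.log (n : ℕ) - Real.log a)
    (fun n => bohrLp q (Finsupp.single n (P n))) (B := hardyNorm q P)
    (fun n hn => sub_nonneg.mpr (Real.log_le_log ha (hP n hn))) (fun τ => by
      rw [key, norm_smul, norm_bohrLp hq, hardyNorm_shift_I, Complex.norm_exp]
      simp) hw
  rw [key, norm_smul, norm_bohrLp hq, Complex.norm_exp, Complex.re_ofReal_mul] at h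
  rw [Real.rpow_def_of_pos ha, mul_neg, Real.exp_neg, inv_mul_eq_div, le_div_iff₀ (Real.exp_pos _),
    mul_comm]
  exact h

/-- Growth of translates to the left. -/
lemma hardyNorm_shift_neg_le {q : ℝ} (hq : 1 ≤ q) {M : ℝ} {P : DirichletPoly}
    (hM : 0 < M) (hP : ∀ n ∈ P.support, ((n : ℕ) : ℝ) ≤ M) {w : ℂ} (hw : 0 ≤ w.re) :
    hardyNorm q (shift (-w) P) ≤ M ^ w.re * hardyNorm q P := by
  have : Fact (1 ≤ ENNReal.ofReal q) := ⟨one_le_ofReal hq⟩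
  -- Reversing the variable and multiplying by `M^{-z}` gives the frequencies `log M - log n ≥ 0`.
  have key : ∀ z : ℂ, ∑ n ∈ P.support, Complex.exp (-(((Real.log M - Real.log (n : ℕ) : ℝ) : ℂ) * z))
      • bohrLp q (Finsupp.single n (P n)) =
      Complex.exp (-((Real.log M : ℝ) * z)) • bohrLp q (shift (-z) P) := fun z => by
    rw [bohrLp_shift, Finset.smul_sum]
    refine Finset.sum_congr rfl fun n _ => ?_
    rw [smul_smul, ← Complex.exp_add]
    congr 2
    push_cast
    ring
  have h := norm_expSum_le_of_imaginary_axis P.support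
    (fun n : ℕ+ => Real.log M - Real.log (n : ℕ))
    (fun n => bohrLp q (Finsupp.single n (P n))) (B := hardyNorm q P)
    (fun n hn => sub_nonneg.mpr (Real.log_le_log (by simp) (hP n hn))) (fun τ => by
      have h1 : -(τ * Complex.I) = ((-τ : ℝ) : ℂ) * Complex.I := by push_cast; ring
      rw [key, norm_smul, norm_bohrLp hq, h1, hardyNorm_shift_I, Complex.norm_exp]
      simp) hw
  rw [key, norm_smul, norm_bohrLp hq, Complex.norm_exp, Complex.neg_re,
    Complex.re_ofReal_mul, Real.exp_neg, inv_mul_le_iff₀ (Real.exp_pos _)] at h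
  rwa [Real.rpow_def_of_pos hM]

/-- Horizontal translations are contractions. -/
lemma hardyNorm_translate_le_self {q : ℝ} (hq : 1 ≤ q) {σ : ℝ} (hσ : 0 ≤ σ) (P : DirichletPoly) :
    hardyNorm q (translate σ P) ≤ hardyNorm q P := by
  have := hardyNorm_shift_le hq one_pos (P := P) (fun n _ => by exact_mod_cast n.pos)
    (w := σ) (by simpa using hσ)
  rwa [Real.one_rpow, one_mul, ← translate_eq_shift] at this

lemma two_le_of_coeff_one_eq_zero {P : DirichletPoly} (hP : P 1 = 0) :
    ∀ n ∈ P.support, (2 : ℝ) ≤ (n : ℕ) := fun n hn => by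
  have : n ≠ 1 := by rintro rfl; exact Finsupp.mem_support_iff.mp hn hP
  have h2 : (n : ℕ) ≠ 1 := fun h => this (PNat.coe_eq_one_iff.mp h)
  have := n.pos
  exact_mod_cast (show 2 ≤ (n : ℕ) by omega)

lemma hardyNorm_translate_le_of_coeff_one {q : ℝ} (hq : 1 ≤ q) {σ : ℝ} (hσ : 0 ≤ σ)
    {P : DirichletPoly} (hP : P 1 = 0) :
    hardyNorm q (translate σ P) ≤ 2 ^ (-σ) * hardyNorm q P := by
  have := hardyNorm_shift_le hq two_pos (two_le_of_coeff_one_eq_zero hP)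
    (w := σ) (by simpa using hσ)
  rwa [← translate_eq_shift] at this

/-- Translate `P_σ` back to the left. For `σ = 1 / log M` the loss is only a factor `e`, which makes
Bergman and Hardy norms comparable on polynomials of length `M`. -/
lemma hardyNorm_le_mul_translate {q : ℝ} (hq : 1 ≤ q) {M σ : ℝ} (hσ : 0 ≤ σ) (hM : 0 < M)
    {P : DirichletPoly} (hP : ∀ n ∈ P.support, ((n : ℕ) : ℝ) ≤ M) :
    hardyNorm q P ≤ M ^ σ * hardyNorm q (translate σ P) := by
  have := hardyNorm_shift_neg_le hq (P := shift σ P) hM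
    (fun n hn => hP n (support_multiplier_subset _ _ hn)) (w := σ) (by simpa using hσ)
  rwa [shift_shift, add_neg_cancel, shift_zero, ← translate_eq_shift] at this

/-! ### Bernstein's inequality -/

lemma hasDerivAt_bohrLp_shift {q : ℝ} (hq : 1 ≤ q) (P : DirichletPoly) :
    haveI : Fact (1 ≤ ENNReal.ofReal q) := ⟨one_le_ofReal hq⟩
    HasDerivAt (fun w => bohrLp q (shift w P))
      (-bohrLp q (multiplier (fun n => (Real.log (n : ℕ) : ℝ)) P)) 0 := by
  have : Fact (1 ≤ ENNReal.ofReal q) := ⟨one_le_ofReal hq⟩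
  simp only [bohrLp_shift]
  rw [bohrLp_multiplier, ← Finset.sum_neg_distrib]
  refine HasDerivAt.fun_sum fun n _ => ?_
  rw [← neg_smul]
  refine HasDerivAt.smul_const ?_ _
  have h := ((hasDerivAt_id (0 : ℂ)).const_mul ((Real.log (n : ℕ) : ℝ) : ℂ)).neg.cexp
  simpa using h

/-- The multiplier `log n` is minus the derivative of `w ↦ shift w P` at `0`. Cauchy's estimate is
used on the circle of radius `1 / log M`, where translates have norm at most `e ‖P‖` because `M^{1 /
log M} = e`. -/
lemma hardyNorm_multiplier_log_le {q : ℝ} (hq : 1 ≤ q) {M : ℝ} (hM : 1 < M) {P : DirichletPoly}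
    (hP : ∀ n ∈ P.support, ((n : ℕ) : ℝ) ≤ M) :
    hardyNorm q (multiplier (fun n => (Real.log (n : ℕ) : ℝ)) P) ≤
      (Real.exp 1 * Real.log M) * hardyNorm q P := by
  have : Fact (1 ≤ ENNReal.ofReal q) := ⟨one_le_ofReal hq⟩
  have hM0 : 0 < M := by linarith
  have hL : 0 < Real.log M := Real.log_pos hM
  have hMR : M ^ (1 / Real.log M) = Real.exp 1 := by
    rw [Real.rpow_def_of_pos hM0, mul_one_div_cancel hL.ne']
  have hnn := hardyNorm_nonneg q P
  have h := Complex.norm_deriv_le_of_forall_mem_sphere_norm_le (c := 0) (R := 1 / Real.log M)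
    (C := Real.exp 1 * hardyNorm q P) (f := fun w => bohrLp q (shift w P)) (by positivity)
    (by
      simp only [bohrLp_shift]
      exact (differentiable_expSum _ _ _).diffContOnCl)
    (fun z hz => by
      have hz' : ‖z‖ = 1 / Real.log M := by simpa using hz
      have hre : |z.re| ≤ 1 / Real.log M := hz' ▸ Complex.abs_re_le_norm z
      rw [norm_bohrLp hq]
      rcases le_total 0 z.re with h0 | h0
      · refine (hardyNorm_shift_le hq one_pos (fun n _ => by exact_mod_cast n.pos) h0).trans ?_
        rw [Real.one_rpow]
        exact mul_le_mul_of_nonneg_right (Real.one_le_exp zero_le_one) hnn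
      · have h1 := hardyNorm_shift_neg_le hq hM0 hP (w := -z) (by simpa using h0)
        rw [neg_neg] at h1
        refine h1.trans (mul_le_mul_of_nonneg_right ?_ hnn)
        rw [← hMR]
        refine Real.rpow_le_rpow_of_exponent_le hM.le ?_
        rw [Complex.neg_re, ← abs_of_nonpos h0]
        exact hre)
  rw [(hasDerivAt_bohrLp_shift hq P).deriv, norm_neg, norm_bohrLp hq] at h
  refine h.trans (le_of_eq ?_)
  field_simp

lemma hardyNorm_multiplier_log_pow_le {q : ℝ} (hq : 1 ≤ q) {M : ℝ} (hM : 1 < M)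
    {P : DirichletPoly} (hP : ∀ n ∈ P.support, ((n : ℕ) : ℝ) ≤ M) (k : ℕ) :
    hardyNorm q (multiplier (fun n => (Real.log (n : ℕ) : ℂ) ^ k) P) ≤
      (Real.exp 1 * Real.log M) ^ k * hardyNorm q P := by
  have hL : 0 < Real.log M := Real.log_pos hM
  induction k with
  | zero =>
    have : multiplier (fun n => (Real.log (n : ℕ) : ℂ) ^ 0) P = P := by
      ext n; simp [multiplier_apply]
    rw [this, pow_zero, one_mul]
  | succ k ih =>
    have h := hardyNorm_multiplier_log_le hq hM
      (P := multiplier (fun n => (Real.log (n : ℕ) : ℂ) ^ k) P)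
      (fun n hn => hP n (support_multiplier_subset _ _ hn))
    rw [multiplier_multiplier] at h
    simp only [← pow_succ] at h
    refine h.trans ?_
    rw [pow_succ', mul_assoc (Real.exp 1 * Real.log M)]
    exact mul_le_mul_of_nonneg_left ih (by positivity)

/-! ### Fractional integration of Dirichlet polynomials -/

/-- Fractional integration of Dirichlet polynomials: the `n`-th coefficient is multiplied by
`(log n)^{-t}`, and the constant term is dropped. -/
noncomputable def fracInt (t : ℝ) : DirichletPoly →ₗ[ℂ] DirichletPoly :=
  multiplier fun n => if n = 1 then 0 else ((Real.log (n : ℕ) ^ (-t) : ℝ) : ℂ)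

lemma one_lt_of_ne_one {n : ℕ+} (hn : n ≠ 1) : (1 : ℝ) < (n : ℕ) := by
  have h : (n : ℕ) ≠ 1 := fun h => hn (PNat.coe_eq_one_iff.mp h)
  have := n.pos
  exact_mod_cast (show 1 < (n : ℕ) by omega)

/-- With `a = n` this is why `I_t` acts on coefficients as multiplication by `(log n)^{-t}`; with `a
= 2` it evaluates the majorants. -/
lemma integral_rpow_mul_rpow_neg {t : ℝ} (ht : 0 < t) {a : ℝ} (ha : 1 < a) :
    ∫ x in Set.Ioi (0 : ℝ), x ^ (t - 1) * a ^ (-x) = Real.Gamma t * Real.log a ^ (-t) := by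
  have hl := Real.log_pos ha
  have := Real.integral_rpow_mul_exp_neg_mul_Ioi ht hl
  rw [Real.rpow_neg hl.le, mul_comm, ← Real.inv_rpow hl.le, ← one_div, ← this]
  refine setIntegral_congr_fun measurableSet_Ioi fun x _ => ?_
  rw [Real.rpow_def_of_pos (by linarith : 0 < a), mul_neg]

lemma integrableOn_rpow_mul_rpow_neg {t : ℝ} (ht : 0 < t) {a : ℝ} (ha : 1 < a) :
    IntegrableOn (fun x : ℝ => x ^ (t - 1) * a ^ (-x)) (Set.Ioi 0) := by
  -- A non-integrable function would have integral `0` by convention, whereas the computed value is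
  -- positive.
  refine Integrable.of_integral_ne_zero ?_
  rw [integral_rpow_mul_rpow_neg ht ha]
  have := Real.rpow_pos_of_pos (Real.log_pos ha) (-t)
  have := Real.Gamma_pos_of_pos ht
  positivity

section FracInt

variable {E : Type*} [NormedAddCommGroup E] [NormedSpace ℂ E]

lemma smul_map_translate (L : DirichletPoly →ₗ[ℂ] E) (t x : ℝ) (P : DirichletPoly) :
    ((x ^ (t - 1) : ℝ) : ℂ) • L (translate x P) = ∑ n ∈ P.support,
      ((x ^ (t - 1) * ((n : ℕ) : ℝ) ^ (-x) : ℝ) : ℂ) • L (Finsupp.single n (P n)) := by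
  conv_lhs => rw [← Finsupp.sum_single P]
  simp only [Finsupp.sum, map_sum, Finset.smul_sum]
  refine Finset.sum_congr rfl fun n _ => ?_
  rw [← L.map_smul, ← L.map_smul]
  congr 1
  rw [translate_single, Finsupp.smul_single, Finsupp.smul_single, Complex.ofReal_mul,
    Complex.ofReal_cpow (Nat.cast_nonneg _)]
  congr 1
  push_cast
  simp only [smul_eq_mul]
  ring

lemma integrableOn_smul_map_translate (L : DirichletPoly →ₗ[ℂ] E) {t : ℝ} (ht : 0 < t)
    {P : DirichletPoly} (hP : P 1 = 0) :
    IntegrableOn (fun x : ℝ => ((x ^ (t - 1) : ℝ) : ℂ) • L (translate x P)) (Set.Ioi 0) := by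
  simp only [smul_map_translate]
  refine integrable_finsetSum _ fun n hn => Integrable.smul_const ?_ _
  have h2 := two_le_of_coeff_one_eq_zero hP n hn
  exact (integrableOn_rpow_mul_rpow_neg ht (by linarith : (1 : ℝ) < (n : ℕ))).ofReal

/-- The target of `L` is left general: `bohrLp q` yields norm estimates for `fracInt`, `polyEval s`
its pointwise values. -/
lemma integral_smul_map_translate [CompleteSpace E] (L : DirichletPoly →ₗ[ℂ] E) {t : ℝ}
    (ht : 0 < t) {P : DirichletPoly} (hP : P 1 = 0) :
    ∫ x in Set.Ioi (0 : ℝ), ((x ^ (t - 1) : ℝ) : ℂ) • L (translate x P) =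
      (Real.Gamma t : ℂ) • L (fracInt t P) := by
  simp only [smul_map_translate]
  have h1 : ∀ n ∈ P.support, (1 : ℝ) < (n : ℕ) := fun n hn => by
    linarith [two_le_of_coeff_one_eq_zero hP n hn]
  have hint : ∀ n ∈ P.support, Integrable (fun x : ℝ =>
      ((x ^ (t - 1) * ((n : ℕ) : ℝ) ^ (-x) : ℝ) : ℂ) • L (Finsupp.single n (P n)))
      (volume.restrict (Set.Ioi 0)) := fun n hn =>
    Integrable.smul_const (integrableOn_rpow_mul_rpow_neg ht (h1 n hn)).ofReal _
  rw [integral_finsetSum _ hint]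
  have h2 : fracInt t P = ∑ n ∈ P.support,
      ((Real.log (n : ℕ) ^ (-t) : ℝ) : ℂ) • Finsupp.single n (P n) := by
    ext m
    rw [fracInt, multiplier_apply, Finsupp.finsetSum_apply]
    by_cases hm : m ∈ P.support
    · have hm1 : m ≠ 1 := fun h => by simpa [h] using h1 m hm
      rw [Finset.sum_eq_single m]
      · simp [hm1, mul_comm]
      · intro n _ hn; simp [hn]
      · exact fun h => absurd hm h
    · rw [Finsupp.notMem_support_iff.mp hm, zero_mul, Finset.sum_eq_zero]
      intro n hn
      have : n ≠ m := fun h => hm (h ▸ hn)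
      simp [this]
  rw [h2, map_sum, Finset.smul_sum]
  refine Finset.sum_congr rfl fun n hn => ?_
  rw [integral_smul_const, map_smul, smul_smul, integral_complex_ofReal,
    integral_rpow_mul_rpow_neg ht (h1 n hn)]
  push_cast
  rfl

end FracInt

/-- Take the norm inside the `L^q`-valued integral of translates. These decay like `2^{-x}` because
the constant term vanishes, and the remaining scalar integral is `Γ(t) (log 2)^{-t}`. -/
lemma hardyNorm_fracInt_le {q : ℝ} (hq : 1 ≤ q) {t : ℝ} (ht : 0 < t) {P : DirichletPoly}
    (hP : P 1 = 0) : hardyNorm q (fracInt t P) ≤ Real.log 2 ^ (-t) * hardyNorm q P := by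
  have : Fact (1 ≤ ENNReal.ofReal q) := ⟨one_le_ofReal hq⟩
  have hG := Real.Gamma_pos_of_pos ht
  have h1 := integral_smul_map_translate (bohrLp q) ht hP
  have h2 : ‖(Real.Gamma t : ℂ) • bohrLp q (fracInt t P)‖ ≤
      ∫ x in Set.Ioi (0 : ℝ), x ^ (t - 1) * 2 ^ (-x) * hardyNorm q P := by
    rw [← h1]
    refine norm_integral_le_of_norm_le
      ((integrableOn_rpow_mul_rpow_neg ht one_lt_two).mul_const _) ?_
    refine (ae_restrict_iff' measurableSet_Ioi).mpr (ae_of_all _ fun x hx => ?_)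
    have hx0 : 0 < x := hx
    rw [norm_smul, norm_bohrLp hq, Complex.norm_real,
      Real.norm_of_nonneg (Real.rpow_nonneg hx0.le _), mul_assoc]
    exact mul_le_mul_of_nonneg_left (hardyNorm_translate_le_of_coeff_one hq hx0.le hP)
      (Real.rpow_nonneg hx0.le _)
  rw [integral_mul_const, integral_rpow_mul_rpow_neg ht one_lt_two, norm_smul, norm_bohrLp hq,
    Complex.norm_real, Real.norm_of_nonneg hG.le, mul_assoc] at h2
  exact le_of_mul_le_mul_left h2 hG

lemma riemannLiouville_polyEval {t : ℝ} (ht : 0 < t) {P : DirichletPoly} (hP : P 1 = 0) (s : ℂ) :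
    riemannLiouville t (fun u => polyEval u P) s = polyEval s (fracInt t P) := by
  have h := integral_smul_map_translate (polyEval s) ht hP
  simp only [polyEval_translate, smul_eq_mul] at h
  have hG := (Real.Gamma_pos_of_pos ht).ne'
  rw [riemannLiouville, h, ← mul_assoc, ← Complex.ofReal_mul, one_div_mul_cancel hG,
    Complex.ofReal_one, one_mul]

/-! ### Comparison of the Hardy and Bergman norms of polynomials. -/

lemma lpNorm_le_of_exponent_le {X : Type*} [MeasurableSpace X] {μ : Measure X}
    [IsProbabilityMeasure μ] {f : X → ℂ} {p q : ℝ≥0∞} (hpq : p ≤ q) (hf : MemLp f q μ) :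
    lpNorm f p μ ≤ lpNorm f q μ := by
  rw [← toReal_eLpNorm hf.1, ← toReal_eLpNorm hf.1]
  exact ENNReal.toReal_mono hf.eLpNorm_ne_top (eLpNorm_le_eLpNorm_of_exponent_le hpq hf.1)

lemma hardyNorm_mono {p q : ℝ} (hq : 1 ≤ q) (hpq : q ≤ p) (P : DirichletPoly) :
    hardyNorm q P ≤ hardyNorm p P := by
  rw [hardyNorm_eq hq, hardyNorm_eq (hq.trans hpq)]
  exact lpNorm_le_of_exponent_le (ENNReal.ofReal_le_ofReal hpq) (memLp_bohrLift _ P)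

lemma integrable_hardyNorm_translate_rpow {q α : ℝ} (hq : 1 ≤ q) (hα : -1 < α)
    (P : DirichletPoly) :
    Integrable (fun σ => hardyNorm q (translate σ P) ^ q) (bergmanMeasure α) := by
  have h := (memLp_hardyNorm_translate hq hα P (ENNReal.ofReal q)).integrable_norm_rpow
    (by simp; linarith) (by simp)
  rw [ENNReal.toReal_ofReal (by linarith)] at h
  simpa only [Real.norm_of_nonneg (hardyNorm_nonneg _ _)] using h

/-- The Bergman norm averages `‖P_σ‖^q` against a probability measure on `σ > 0`, where translation
is a contraction. -/
lemma bergmanNorm_le_hardyNorm {q α : ℝ} (hq : 1 ≤ q) (hα : -1 < α) (P : DirichletPoly) :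
    bergmanNorm q α P ≤ hardyNorm q P := by
  have := isProbabilityMeasure_bergmanMeasure hα
  have hq0 : 0 < q := by linarith
  have hM := hardyNorm_nonneg q P
  have hint := integrable_hardyNorm_translate_rpow hq hα P
  have h1 : ∫ σ, hardyNorm q (translate σ P) ^ q ∂(bergmanMeasure α) ≤ hardyNorm q P ^ q := by
    have h2 : ∫ σ, hardyNorm q (translate σ P) ^ q ∂(bergmanMeasure α) ≤
        ∫ _, hardyNorm q P ^ q ∂(bergmanMeasure α) := by
      refine integral_mono_ae hint (integrable_const _) ?_
      filter_upwards [bergmanMeasure_ae α] with σ hσ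
      exact Real.rpow_le_rpow (hardyNorm_nonneg _ _) (hardyNorm_translate_le_self hq hσ.le P) hq0.le
    simpa using h2
  refine (Real.rpow_le_rpow (integral_nonneg fun σ => Real.rpow_nonneg (hardyNorm_nonneg _ _) _)
    h1 (by positivity)).trans (le_of_eq ?_)
  rw [← Real.rpow_mul hM, mul_one_div_cancel hq0.ne', Real.rpow_one]

/-! ### Extension of bounded operators to the completions -/

namespace SeriesSpace

variable {N₁ N₂ : Seminorm ℂ DirichletPoly}

lemma exists_seq_tendsto (f : SeriesSpace N₁) :
    ∃ u : ℕ → DirichletPoly, Tendsto (fun k => ofPoly N₁ (u k)) atTop (𝓝 f) := by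
  obtain ⟨v, hv, hv'⟩ := mem_closure_iff_seq_limit.mp
    (UniformSpace.Completion.denseRange_coe (α := NormedPoly N₁) f)
  choose w hw using hv
  refine ⟨w, ?_⟩
  have : (fun k => ofPoly N₁ (w k)) = v := funext hw
  rwa [this]

/-- Reduces the sufficiency statements to estimates on polynomials. Only continuity and the norm
bound are recorded, since values are identified afterwards along approximating sequences. -/
lemma exists_extension (T : DirichletPoly →ₗ[ℂ] DirichletPoly) {C : ℝ}
    (hT : ∀ P, N₂ (T P) ≤ C * N₁ P) :
    ∃ T' : SeriesSpace N₁ → SeriesSpace N₂, Continuous T' ∧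
      (∀ P, T' (ofPoly N₁ P) = ofPoly N₂ (T P)) ∧ ∀ f, ‖T' f‖ ≤ C * ‖f‖ := by
  let T₀ : NormedPoly N₁ →ₗ[ℂ] NormedPoly N₂ := T
  let T₁ : NormedPoly N₁ →L[ℂ] NormedPoly N₂ := T₀.mkContinuous C hT
  have hu : UniformContinuous T₁ := T₁.uniformContinuous
  have hcont : Continuous (UniformSpace.Completion.map T₁) := UniformSpace.Completion.continuous_map
  have hmap : ∀ P, UniformSpace.Completion.map T₁ (ofPoly N₁ P) = ofPoly N₂ (T P) :=
    fun P => UniformSpace.Completion.map_coe hu (show NormedPoly N₁ from P)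
  refine ⟨UniformSpace.Completion.map T₁, hcont, hmap, fun f => ?_⟩
  obtain ⟨u, hu⟩ := exists_seq_tendsto f
  refine le_of_tendsto_of_tendsto' ((hcont.tendsto f).comp hu).norm
    (hu.norm.const_mul C) fun k => ?_
  simp only [Function.comp_apply, hmap, norm_ofPoly]
  exact hT _

end SeriesSpace

lemma continuous_hardy_eval {p : ℝ} (hp : 1 ≤ p) (s : ℂ) :
    Continuous fun f : HardySpace p hp => f.eval s :=
  UniformSpace.Completion.continuous_extension

lemma continuous_hardy_coeff {p : ℝ} (hp : 1 ≤ p) (n : ℕ+) :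
    Continuous fun f : HardySpace p hp => f.coeff n :=
  UniformSpace.Completion.continuous_extension

lemma continuous_bergman_eval {q α : ℝ} (hq : 1 ≤ q) (hα : -1 < α) (s : ℂ) :
    Continuous fun f : BergmanSpace q α hq hα => f.eval s :=
  UniformSpace.Completion.continuous_extension

lemma continuous_bergman_coeff {q α : ℝ} (hq : 1 ≤ q) (hα : -1 < α) (n : ℕ+) :
    Continuous fun f : BergmanSpace q α hq hα => f.coeff n :=
  UniformSpace.Completion.continuous_extension

lemma bergman_coeff_ofPoly {q α : ℝ} (hq : 1 ≤ q) (hα : -1 < α) (n : ℕ+) (P : DirichletPoly) :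
    (SeriesSpace.ofPoly (bergmanSeminorm q α hq hα) P).coeff n = P n :=
  UniformSpace.Completion.extension_coe (bergman_coeff_uniformContinuous hq hα n)
    (show NormedPoly _ from P)

/-! ### Sufficiency of `q ≤ p` -/

/-- Extend the identity on polynomials by density; point evaluations are continuous on both spaces
and agree on polynomials, hence agree in the limit. -/
lemma inclusionBounded_of_le {p q β : ℝ} (hp : 1 ≤ p) (hq : 1 ≤ q) (hβ : -1 < β) (hqp : q ≤ p) :
    InclusionBounded p q β hp hq hβ := by
  obtain ⟨T, hT, hT1, hT2⟩ := SeriesSpace.exists_extension (N₁ := hardySeminorm p hp)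
    (N₂ := bergmanSeminorm q β hq hβ) LinearMap.id (C := 1) fun P => by
      rw [one_mul]
      exact (bergmanNorm_le_hardyNorm hq hβ P).trans (hardyNorm_mono hq hqp P)
  refine ⟨1, fun f => ⟨T f, hT2 f, fun s hs => ?_⟩⟩
  obtain ⟨u, hu⟩ := SeriesSpace.exists_seq_tendsto f
  refine tendsto_nhds_unique
    (((continuous_bergman_eval hq hβ s).comp hT).tendsto f |>.comp hu)
    ((((continuous_hardy_eval hp s).tendsto f).comp hu).congr fun k => ?_)
  simp only [Function.comp_apply, hT1, bergman_eval_ofPoly hq hβ hs, hardy_eval_ofPoly hp hs]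
  rfl

/-- A Dirichlet polynomial without its constant term. -/
noncomputable def dropConst : DirichletPoly →ₗ[ℂ] DirichletPoly :=
  multiplier fun n => if n = 1 then 0 else 1

lemma dropConst_apply_one (P : DirichletPoly) : dropConst P 1 = 0 := by
  simp [dropConst, multiplier_apply]

lemma dropConst_eq (P : DirichletPoly) : dropConst P = P - Finsupp.single 1 (P 1) := by
  ext n
  by_cases h : n = 1
  · subst h; simp [dropConst, multiplier_apply]
  · simp [dropConst, multiplier_apply, h]

lemma hardyNorm_single_one {p : ℝ} (hp : 1 ≤ p) (c : ℂ) :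
    hardyNorm p (Finsupp.single 1 c) = ‖c‖ := by
  have hp0 : 0 < p := by linarith
  simp only [hardyNorm, bohrLift_single, map_one, Circle.coe_one, mul_one, integral_const,
    probReal_univ, one_smul]
  rw [← Real.rpow_mul (norm_nonneg _), mul_one_div_cancel hp0.ne', Real.rpow_one]

lemma hardyNorm_sub_le {p : ℝ} (hp : 1 ≤ p) (P Q : DirichletPoly) :
    hardyNorm p (P - Q) ≤ hardyNorm p P + hardyNorm p Q :=
  map_sub_le_add (hardySeminorm p hp) P Q

/-- Polynomials approximating an `f` with `a₁ = 0` may have constant terms of their own. Removing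
them at most doubles the norm, since `|a₁| ≤ ‖P‖`. -/
lemma hardyNorm_dropConst_le {p : ℝ} (hp : 1 ≤ p) (P : DirichletPoly) :
    hardyNorm p (dropConst P) ≤ 2 * hardyNorm p P := by
  rw [dropConst_eq]
  refine (hardyNorm_sub_le hp _ _).trans ?_
  rw [hardyNorm_single_one hp]
  linarith [norm_coeff_le_hardyNorm hp P 1]

/-- Exponential decay to the right, uniform on bounded sets of polynomials: the source of the
majorant for dominated convergence below. -/
lemma norm_polyEval_add_le {p : ℝ} (hp : 1 ≤ p) {s : ℂ} (hs : 1 / 2 < s.re) {P : DirichletPoly}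
    (hP : P 1 = 0) {x : ℝ} (hx : 0 ≤ x) :
    ‖polyEval (x + s) P‖ ≤ evalBound s.re * (2 ^ (-x) * hardyNorm p P) := by
  rw [← polyEval_translate]
  exact (norm_polyEval_le hp hs _).trans (mul_le_mul_of_nonneg_left
    (hardyNorm_translate_le_of_coeff_one hp hx hP) (evalBound_nonneg _))

/-- The operator `fracInt t ∘ₗ dropConst` is extended by density. That the extension is given by the
integral, and that the integral converges absolutely, follows by dominated convergence along an
approximating sequence. -/
lemma riemannLiouvilleBounded_of_le {p q α t : ℝ} (hp : 1 ≤ p) (hq : 1 ≤ q) (hα : -1 < α)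
    (ht : 0 < t) (hqp : q ≤ p) : RiemannLiouvilleBounded t p q α hp hq hα := by
  obtain ⟨T, hT, hT1, hT2⟩ := SeriesSpace.exists_extension (N₁ := hardySeminorm p hp)
    (N₂ := bergmanSeminorm q α hq hα) (fracInt t ∘ₗ dropConst) (C := Real.log 2 ^ (-t) * 2)
    fun P => by
      have h0 : 0 ≤ Real.log 2 ^ (-t) := Real.rpow_nonneg (Real.log_nonneg one_le_two) _
      calc bergmanNorm q α (fracInt t (dropConst P))
          ≤ hardyNorm q (fracInt t (dropConst P)) := bergmanNorm_le_hardyNorm hq hα _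
        _ ≤ Real.log 2 ^ (-t) * hardyNorm q (dropConst P) :=
          hardyNorm_fracInt_le hq ht (dropConst_apply_one P)
        _ ≤ Real.log 2 ^ (-t) * (2 * hardyNorm p P) := mul_le_mul_of_nonneg_left
          ((hardyNorm_dropConst_le hq P).trans (mul_le_mul_of_nonneg_left
            (hardyNorm_mono hq hqp P) zero_le_two)) h0
        _ = _ := (mul_assoc _ _ _).symm
  refine ⟨_, fun f hf => ⟨T f, hT2 f, fun s hs => ?_⟩⟩
  obtain ⟨u, hu⟩ := SeriesSpace.exists_seq_tendsto f
  set v : ℕ → DirichletPoly := fun k => dropConst (u k) with hv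
  have hv1 : ∀ k, v k 1 = 0 := fun k => dropConst_apply_one _
  obtain ⟨B, hB⟩ := hu.norm.bddAbove_range
  have hvB : ∀ k, hardyNorm p (v k) ≤ 2 * B := fun k => by
    have h : hardyNorm p (u k) ≤ B := by
      have : ‖SeriesSpace.ofPoly (hardySeminorm p hp) (u k)‖ ≤ B := hB ⟨k, rfl⟩
      rw [SeriesSpace.norm_ofPoly] at this
      exact this
    linarith [hardyNorm_dropConst_le hp (u k)]
  -- The dropped constant terms tend to the first coefficient of `f`, which is zero, so the
  -- pointwise limit is unchanged.
  have hveval : ∀ w : ℂ, 1 / 2 < w.re →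
      Tendsto (fun k => polyEval w (v k)) atTop (𝓝 (f.eval w)) := fun w hw => by
    have h1 := ((continuous_hardy_eval hp w).tendsto f).comp hu
    have h2 := ((continuous_hardy_coeff hp 1).tendsto f).comp hu
    rw [hf] at h2
    have h3 := h1.sub h2
    rw [sub_zero] at h3
    refine h3.congr fun k => ?_
    simp only [Function.comp_apply, hardy_eval_ofPoly hp hw, hardy_coeff_ofPoly hp, hv,
      dropConst_eq, map_sub, polyEval_single]
    simp
  set F : ℕ → ℝ → ℂ := fun k x => ((x ^ (t - 1) : ℝ) : ℂ) * polyEval (x + s) (v k) with hF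
  have hFint : ∀ k, IntegrableOn (F k) (Set.Ioi 0) := fun k => by
    have := integrableOn_smul_map_translate (polyEval s) ht (hv1 k)
    simpa only [polyEval_translate, smul_eq_mul] using this
  set b : ℝ → ℝ := fun x => x ^ (t - 1) * 2 ^ (-x) * (evalBound s.re * (2 * B)) with hb
  have hbint : IntegrableOn b (Set.Ioi 0) :=
    (integrableOn_rpow_mul_rpow_neg ht one_lt_two).mul_const _
  have hFb : ∀ k, ∀ᵐ x ∂(volume.restrict (Set.Ioi (0 : ℝ))), ‖F k x‖ ≤ b x := fun k => by
    refine (ae_restrict_iff' measurableSet_Ioi).mpr (ae_of_all _ fun x hx => ?_)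
    have hx0 : 0 < x := hx
    rw [hF, hb, norm_mul, Complex.norm_real, Real.norm_of_nonneg (Real.rpow_nonneg hx0.le _)]
    simp only [mul_assoc]
    refine mul_le_mul_of_nonneg_left ?_ (Real.rpow_nonneg hx0.le _)
    refine (norm_polyEval_add_le hp hs (hv1 k) hx0.le).trans ?_
    rw [← mul_assoc, mul_comm (evalBound _), mul_assoc]
    have := evalBound_nonneg s.re
    gcongr
    exact hvB k
  have hFlim : ∀ᵐ x ∂(volume.restrict (Set.Ioi (0 : ℝ))), Tendsto (fun k => F k x) atTop
      (𝓝 (((x ^ (t - 1) : ℝ) : ℂ) * f.eval (x + s))) := by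
    refine (ae_restrict_iff' measurableSet_Ioi).mpr (ae_of_all _ fun x hx => ?_)
    have hx0 : 0 < x := hx
    exact (hveval _ (by simp; linarith)).const_mul _
  refine ⟨?_, ?_⟩
  · have hmeas := aestronglyMeasurable_of_tendsto_ae atTop (fun k => (hFint k).1) hFlim
    refine Integrable.mono' hbint hmeas ?_
    filter_upwards [hFlim, ae_all_iff.mpr hFb] with x hx hxb
    exact le_of_tendsto' hx.norm hxb
  · have h1 := ((continuous_bergman_eval hq hα s).comp hT).tendsto f |>.comp hu
    have h2 := (tendsto_integral_of_dominated_convergence b (fun k => (hFint k).1) hbint hFb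
      hFlim).const_mul ((1 / Real.Gamma t : ℝ) : ℂ)
    refine tendsto_nhds_unique h1 (h2.congr fun k => ?_)
    simp only [Function.comp_apply, hT1, bergman_eval_ofPoly hq hα hs]
    exact riemannLiouville_polyEval ht (hv1 k) s

/-! ### Lower bounds for Bergman norms -/

/-- On `(0, 1)` the factor `e^{-2σ}` is at least `e^{-2}`, so the density dominates a multiple of
`σ^α`, which is integrated over `(0, δ)`. -/
lemma exists_le_bergmanMeasure_Ioo {α : ℝ} (hα : -1 < α) :
    ∃ c : ℝ, 0 < c ∧ ∀ δ : ℝ, 0 < δ → δ ≤ 1 →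
      c * δ ^ (α + 1) ≤ (bergmanMeasure α).real (Set.Ioo 0 δ) := by
  have := isProbabilityMeasure_bergmanMeasure hα
  have hα1 : 0 < α + 1 := by linarith
  have hG := Real.Gamma_pos_of_pos hα1
  set K : ℝ := 2 ^ (α + 1) / Real.Gamma (α + 1) * Real.exp (-2) with hK
  have hK0 : 0 < K := by positivity
  refine ⟨K / (α + 1), by positivity, fun δ hδ hδ1 => ?_⟩
  have hii : IntervalIntegrable (fun x : ℝ => K * x ^ α) volume 0 δ :=
    (intervalIntegral.intervalIntegrable_rpow' hα).const_mul K
  have hint : IntegrableOn (fun x : ℝ => K * x ^ α) (Set.Ioo 0 δ) :=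
    ((intervalIntegrable_iff_integrableOn_Ioo_of_le hδ.le).mp hii)
  have hval : ∫ x in Set.Ioo 0 δ, K * x ^ α = K / (α + 1) * δ ^ (α + 1) := by
    rw [← integral_Ioc_eq_integral_Ioo, ← intervalIntegral.integral_of_le hδ.le,
      intervalIntegral.integral_const_mul, integral_rpow (Or.inl hα), Real.zero_rpow hα1.ne']
    ring
  rw [← hval, Measure.real, ← ENNReal.ofReal_le_iff_le_toReal (measure_ne_top _ _),
    ofReal_integral_eq_lintegral_ofReal hint ((ae_restrict_iff' measurableSet_Ioo).mpr
      (ae_of_all _ fun x hx => mul_nonneg hK0.le (Real.rpow_nonneg hx.1.le _))),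
    bergmanMeasure, ProbabilityTheory.gammaMeasure, withDensity_apply _ measurableSet_Ioo]
  refine setLIntegral_mono' measurableSet_Ioo fun x hx => ?_
  rw [ProbabilityTheory.gammaPDF_of_nonneg hx.1.le]
  refine ENNReal.ofReal_le_ofReal ?_
  rw [hK, add_sub_cancel_right, mul_right_comm]
  have := Real.rpow_nonneg hx.1.le α
  gcongr
  linarith [hx.2]


lemma translate_add (σ τ : ℝ) (P : DirichletPoly) :
    translate σ (translate τ P) = translate (τ + σ) P := by
  rw [translate_eq_shift, translate_eq_shift, shift_shift, translate_eq_shift, Complex.ofReal_add]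

lemma hardyNorm_translate_anti {q : ℝ} (hq : 1 ≤ q) {σ δ : ℝ} (h : σ ≤ δ) (P : DirichletPoly) :
    hardyNorm q (translate δ P) ≤ hardyNorm q (translate σ P) := by
  have := hardyNorm_translate_le_self hq (sub_nonneg.mpr h) (translate σ P)
  rwa [translate_add, add_sub_cancel] at this

/-- Since `σ ↦ ‖P_σ‖` decreases, it is at least `‖P_δ‖` on `(0, δ)`; restrict the integral to that
interval. -/
lemma measure_rpow_mul_hardyNorm_le_bergmanNorm {q α : ℝ} (hq : 1 ≤ q) (hα : -1 < α) (δ : ℝ)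
    (P : DirichletPoly) :
    (bergmanMeasure α).real (Set.Ioo 0 δ) ^ (1 / q) * hardyNorm q (translate δ P) ≤
      bergmanNorm q α P := by
  have := isProbabilityMeasure_bergmanMeasure hα
  have hq0 : 0 < q := by linarith
  set μ := bergmanMeasure α
  set c := hardyNorm q (translate δ P) with hc
  have hc0 : 0 ≤ c := hardyNorm_nonneg _ _
  have hint : Integrable (fun σ => hardyNorm q (translate σ P) ^ q) μ :=
    integrable_hardyNorm_translate_rpow hq hα P
  have h1 : μ.real (Set.Ioo 0 δ) * c ^ q ≤ ∫ σ, hardyNorm q (translate σ P) ^ q ∂μ := by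
    calc μ.real (Set.Ioo 0 δ) * c ^ q = ∫ _ in Set.Ioo 0 δ, c ^ q ∂μ := by
          rw [setIntegral_const, smul_eq_mul]
      _ ≤ ∫ σ in Set.Ioo 0 δ, hardyNorm q (translate σ P) ^ q ∂μ :=
          setIntegral_mono_on (integrable_const _).integrableOn hint.integrableOn
            measurableSet_Ioo fun σ hσ => Real.rpow_le_rpow hc0
              (hardyNorm_translate_anti hq hσ.2.le P) hq0.le
      _ ≤ _ := setIntegral_le_integral hint
          (ae_of_all _ fun σ => Real.rpow_nonneg (hardyNorm_nonneg _ _) _)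
  have h2 := Real.rpow_le_rpow (by positivity) h1 (by positivity : 0 ≤ 1 / q)
  rwa [Real.mul_rpow measureReal_nonneg (by positivity), ← Real.rpow_mul hc0,
    mul_one_div_cancel hq0.ne', Real.rpow_one] at h2

lemma exists_hardyNorm_translate_le_bergmanNorm {q α : ℝ} (hq : 1 ≤ q) (hα : -1 < α) {δ : ℝ}
    (hδ : 0 < δ) (hδ1 : δ ≤ 1) : ∃ C : ℝ, 0 ≤ C ∧ ∀ P : DirichletPoly,
      hardyNorm q (translate δ P) ≤ C * bergmanNorm q α P := by
  obtain ⟨c, hc, h⟩ := exists_le_bergmanMeasure_Ioo hα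
  have hv : 0 < (bergmanMeasure α).real (Set.Ioo 0 δ) ^ (1 / q) :=
    Real.rpow_pos_of_pos ((mul_pos hc (Real.rpow_pos_of_pos hδ _)).trans_le (h δ hδ hδ1)) _
  refine ⟨_, (inv_pos.mpr hv).le, fun P => ?_⟩
  rw [le_inv_mul_iff₀ hv]
  exact measure_rpow_mul_hardyNorm_le_bergmanNorm hq hα δ P

/-! ### Uniqueness of the Dirichlet series of an element of a Bergman space -/

lemma hardyNorm_shift (q : ℝ) (w : ℂ) (P : DirichletPoly) :
    hardyNorm q (shift w P) = hardyNorm q (translate w.re P) := by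
  rw [translate_eq_shift, ← hardyNorm_shift_I q w.im (shift w.re P), shift_shift, Complex.re_add_im]

/-- Logarithmic convexity of `σ ↦ ‖P_σ‖`. -/
lemma hardyNorm_translate_le_interp {q : ℝ} (hq : 1 ≤ q) {l u σ : ℝ} (hl : 0 ≤ l) (h1 : l ≤ σ)
    (h2 : σ ≤ u) (hlu : l < u) (P : DirichletPoly) :
    hardyNorm q (translate σ P) ≤ hardyNorm q (translate l P) ^ (1 - (σ - l) / (u - l)) *
      hardyNorm q (translate u P) ^ ((σ - l) / (u - l)) := by
  have : Fact (1 ≤ ENNReal.ofReal q) := ⟨one_le_ofReal hq⟩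
  have hn : ∀ w, ‖bohrLp q (shift w P)‖ = hardyNorm q (translate w.re P) := fun w => by
    rw [norm_bohrLp hq, hardyNorm_shift]
  have h := Complex.HadamardThreeLines.norm_le_interp_of_mem_verticalClosedStrip'
    (f := fun w => bohrLp q (shift w P)) (z := (σ : ℂ)) (l := l) (u := u)
    (a := hardyNorm q (translate l P)) (b := hardyNorm q (translate u P)) hlu
    (by simpa [Complex.HadamardThreeLines.verticalClosedStrip] using ⟨h1, h2⟩)
    (by
      simp only [bohrLp_shift]
      exact (differentiable_expSum _ _ _).diffContOnCl)
    ⟨hardyNorm q P, by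
      rintro _ ⟨w, hw, rfl⟩
      simp only [Function.comp_apply, hn]
      exact hardyNorm_translate_le_self hq (hl.trans hw.1) P⟩
    (fun z hz => by rw [hn, show z.re = l from hz])
    (fun z hz => by rw [hn, show z.re = u from hz])
  simpa only [hn, Complex.ofReal_re] using h

lemma polyEval_eq_tsum (s : ℂ) (P : DirichletPoly) :
    polyEval s P = ∑' n : ℕ+, P n * ((n : ℕ) : ℂ) ^ (-s) := by
  rw [tsum_eq_sum (s := P.support) fun n hn => by rw [Finsupp.notMem_support_iff.mp hn, zero_mul],
    polyEval, Finsupp.linearCombination_apply]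
  rfl

lemma summable_pnat_rpow {x : ℝ} (hx : x < -1) : Summable fun n : ℕ+ => ((n : ℕ) : ℝ) ^ x :=
  (Real.summable_nat_rpow.mpr hx).comp_injective PNat.coe_injective

/-- A Dirichlet series with polynomially bounded coefficients that vanishes for large real
arguments has vanishing coefficients. -/
lemma coeff_eq_zero_of_tsum_eq_zero {c : ℕ+ → ℂ} {B : ℝ} (hB : ∀ n, ‖c n‖ ≤ B * (n : ℕ))
    (h : ∀ x : ℝ, 2 < x → ∑' n : ℕ+, c n * ((n : ℕ) : ℂ) ^ (-(x : ℂ)) = 0) (n : ℕ+) : c n = 0 := by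
  set c' : ℕ → ℂ := fun m => if hm : 0 < m then c ⟨m, hm⟩ else 0 with hc'
  have hcc : ∀ m : ℕ+, c' m = c m := fun m => by
    simp only [hc', m.pos, dite_true]; rfl
  have hL : (fun x : ℝ => LSeries c' x) =ᶠ[atTop] 0 := by
    filter_upwards [eventually_gt_atTop 2] with x hx
    rw [Pi.zero_apply, ← h x hx, LSeries, ← PNat.coe_injective.tsum_eq]
    · refine tsum_congr fun m => ?_
      rw [LSeries.term_of_ne_zero m.ne_zero, hcc, Complex.cpow_neg, div_eq_mul_inv]
    · intro m hm
      have : m ≠ 0 := by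
        rintro rfl
        exact hm (LSeries.term_zero _ _)
      exact ⟨⟨m, Nat.pos_of_ne_zero this⟩, rfl⟩
  rcases LSeries_eventually_eq_zero_iff'.mp hL with h0 | h0
  · rw [← hcc]
    exact h0 _ n.ne_zero
  -- The other alternative is a series with abscissa of absolute convergence `⊤`, which linear
  -- growth of the coefficients excludes.
  · exfalso
    have h2 : LSeries.abscissaOfAbsConv c' ≤ ((1 : ℝ) : EReal) + 1 :=
      LSeries.abscissaOfAbsConv_le_of_le_const_mul_rpow ⟨B, fun m hm => by
        have h3 : c' m = c ⟨m, Nat.pos_of_ne_zero hm⟩ := hcc ⟨m, Nat.pos_of_ne_zero hm⟩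
        rw [h3, Real.rpow_one]
        exact hB _⟩
    rw [h0] at h2
    exact absurd (lt_of_le_of_lt h2 (by
      rw [← EReal.coe_one, ← EReal.coe_add]; exact EReal.coe_lt_top _)) (lt_irrefl _)

/-- Dirichlet polynomials that are bounded in a Bergman space, with convergent coefficients, and
tend to zero pointwise, tend to zero in the Hardy norm after any horizontal translation. -/
lemma tendsto_hardyNorm_translate_zero {q α : ℝ} (hq : 1 ≤ q) (hα : -1 < α)
    {R : ℕ → DirichletPoly} {B : ℝ} (hR : ∀ k, bergmanNorm q α (R k) ≤ B)
    {c : ℕ+ → ℂ} (hc : ∀ n, Tendsto (fun k => R k n) atTop (𝓝 (c n)))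
    (h0 : ∀ s : ℂ, 1 / 2 < s.re → Tendsto (fun k => polyEval s (R k)) atTop (𝓝 0))
    {δ : ℝ} (hδ : 0 < δ) (hδ1 : δ ≤ 1) :
    Tendsto (fun k => hardyNorm q (translate δ (R k))) atTop (𝓝 0) := by
  obtain ⟨C₁, hC₁, hb₁⟩ := exists_hardyNorm_translate_le_bergmanNorm hq hα one_pos le_rfl
  have hcoef : ∀ k n, ‖R k n‖ ≤ C₁ * B * (n : ℕ) := fun k n => by
    have h1 := norm_coeff_le_hardyNorm hq (translate 1 (R k)) n
    rw [translate_apply, norm_mul, norm_natCast_cpow, Complex.neg_re, Complex.ofReal_re,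
      Real.rpow_neg_one, ← div_eq_mul_inv, div_le_iff₀ (by simp)] at h1
    refine h1.trans (mul_le_mul_of_nonneg_right ?_ (Nat.cast_nonneg _))
    exact (hb₁ _).trans (mul_le_mul_of_nonneg_left (hR k) hC₁)
  have hcB : ∀ n, ‖c n‖ ≤ C₁ * B * (n : ℕ) := fun n =>
    le_of_tendsto' (hc n).norm fun k => hcoef k n
  have hdom : ∀ x : ℝ, 2 < x → ∀ k (n : ℕ+), ‖R k n‖ * ((n : ℕ) : ℝ) ^ (-x) ≤
      C₁ * B * ((n : ℕ) : ℝ) ^ (1 - x) := fun x hx k n => by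
    have hn : (0 : ℝ) < (n : ℕ) := by simp
    rw [show 1 - x = 1 + -x by ring, Real.rpow_add hn, Real.rpow_one, ← mul_assoc]
    exact mul_le_mul_of_nonneg_right (hcoef k n) (Real.rpow_nonneg hn.le _)
  have hsumm : ∀ x : ℝ, 2 < x → Summable fun n : ℕ+ => C₁ * B * ((n : ℕ) : ℝ) ^ (1 - x) :=
    fun x hx => (summable_pnat_rpow (by linarith)).mul_left _
  -- For `x > 2` the linear coefficient bound allows the limit to pass inside the series. The series
  -- with coefficients `c` therefore vanishes there, which forces `c = 0`.
  have hc0 : ∀ n, c n = 0 := coeff_eq_zero_of_tsum_eq_zero hcB fun x hx => by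
    have h1 : Tendsto (fun k => ∑' n : ℕ+, R k n * ((n : ℕ) : ℂ) ^ (-(x : ℂ))) atTop
        (𝓝 (∑' n : ℕ+, c n * ((n : ℕ) : ℂ) ^ (-(x : ℂ)))) :=
      tendsto_tsum_of_dominated_convergence (hsumm x hx) (fun n => (hc n).mul_const _)
        (Eventually.of_forall fun k n => by
          rw [norm_mul, norm_natCast_cpow, Complex.neg_re, Complex.ofReal_re]
          exact hdom x hx k n)
    simp only [← polyEval_eq_tsum] at h1
    exact tendsto_nhds_unique h1 (h0 x (by simp; linarith))
  -- At abscissa `3` the sum of the absolute values of the terms bounds the norm, with the summable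
  -- majorant `n^{-2}` up to a constant.
  have h3 : Tendsto (fun k => hardyNorm q (translate 3 (R k))) atTop (𝓝 0) := by
    have h1 : Tendsto (fun k => ∑' n : ℕ+, ‖R k n‖ * ((n : ℕ) : ℝ) ^ (-3 : ℝ)) atTop
        (𝓝 (∑' n : ℕ+, ‖c n‖ * ((n : ℕ) : ℝ) ^ (-3 : ℝ))) :=
      tendsto_tsum_of_dominated_convergence (hsumm 3 (by norm_num))
        (fun n => (hc n).norm.mul_const _) (Eventually.of_forall fun k n => by
          rw [Real.norm_of_nonneg (by positivity)]
          exact hdom 3 (by norm_num) k n)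
    simp only [hc0, norm_zero, zero_mul, tsum_zero] at h1
    refine squeeze_zero (fun k => hardyNorm_nonneg _ _) (fun k => ?_) h1
    refine (hardyNorm_le_sum hq _).trans (le_of_eq ?_)
    rw [tsum_eq_sum (s := (translate 3 (R k)).support)]
    · refine Finset.sum_congr rfl fun n _ => ?_
      beta_reduce
      rw [translate_apply, norm_mul, norm_natCast_cpow]
      simp
    · intro n hn
      have := Finsupp.notMem_support_iff.mp hn
      rw [translate_apply, mul_eq_zero, or_iff_left] at this
      · rw [this, norm_zero, zero_mul]
      · rw [← ne_eq, ← norm_ne_zero_iff, norm_natCast_cpow]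
        exact (Real.rpow_pos_of_pos (by simp) _).ne'
  -- The three lines inequality interpolates between `δ / 2`, where the Bergman bound controls the
  -- norms, and `3`, where they tend to zero.
  obtain ⟨C₂, hC₂, hb₂⟩ := exists_hardyNorm_translate_le_bergmanNorm hq hα (half_pos hδ)
    (by linarith)
  set θ : ℝ := (δ - δ / 2) / (3 - δ / 2) with hθ
  have hθ0 : 0 < θ := div_pos (by linarith) (by linarith)
  have hθ1 : θ ≤ 1 := (div_le_one (by linarith)).mpr (by linarith)
  have h4 : Tendsto (fun k => (C₂ * B) ^ (1 - θ) * hardyNorm q (translate 3 (R k)) ^ θ) atTop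
      (𝓝 0) := by
    have := (h3.rpow_const (p := θ) (Or.inr hθ0.le)).const_mul ((C₂ * B) ^ (1 - θ))
    rwa [Real.zero_rpow hθ0.ne', mul_zero] at this
  refine squeeze_zero (fun k => hardyNorm_nonneg _ _) (fun k => ?_) h4
  refine (hardyNorm_translate_le_interp hq (l := δ / 2) (u := 3) (by linarith) (by linarith)
    (by linarith) (by linarith) (R k)).trans ?_
  refine mul_le_mul_of_nonneg_right ?_ (Real.rpow_nonneg (hardyNorm_nonneg _ _) _)
  exact Real.rpow_le_rpow (hardyNorm_nonneg _ _)
    ((hb₂ _).trans (mul_le_mul_of_nonneg_left (hR k) hC₂)) (by linarith)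

/-- An element of a Bergman space which coincides with a Dirichlet polynomial on `Re s > 1/2` has
at least the norm expected from that polynomial. -/
lemma measure_rpow_mul_hardyNorm_le_norm {q α : ℝ} (hq : 1 ≤ q) (hα : -1 < α)
    {g : BergmanSpace q α hq hα} {Q : DirichletPoly}
    (hg : ∀ s : ℂ, 1 / 2 < s.re → g.eval s = polyEval s Q) {δ : ℝ} (hδ : 0 < δ) (hδ1 : δ ≤ 1) :
    (bergmanMeasure α).real (Set.Ioo 0 δ) ^ (1 / q) * hardyNorm q (translate δ Q) ≤ ‖g‖ := by
  obtain ⟨u, hu⟩ := SeriesSpace.exists_seq_tendsto g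
  have hnorm : ∀ k, ‖SeriesSpace.ofPoly (bergmanSeminorm q α hq hα) (u k)‖ =
      bergmanNorm q α (u k) := fun k => SeriesSpace.norm_ofPoly _ _
  obtain ⟨B, hB⟩ := hu.norm.bddAbove_range
  -- Only the values of `g` on `Re s > 1/2` are known. The differences `u k - Q` are bounded in the
  -- Bergman norm and tend to zero at those points, which suffices after translation.
  have hR : Tendsto (fun k => hardyNorm q (translate δ (u k - Q))) atTop (𝓝 0) := by
    refine tendsto_hardyNorm_translate_zero hq hα (B := B + bergmanNorm q α Q) (fun k => ?_)
      (c := fun n => g.coeff n - Q n) (fun n => ?_) (fun s hs => ?_) hδ hδ1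
    · have h1 : bergmanNorm q α (u k) ≤ B := by
        rw [← hnorm]
        exact hB ⟨k, rfl⟩
      have h2 : bergmanNorm q α (u k - Q) ≤ bergmanNorm q α (u k) + bergmanNorm q α Q :=
        map_sub_le_add (bergmanSeminorm q α hq hα) (u k) Q
      linarith
    · refine Tendsto.congr (fun k => ?_)
        ((((continuous_bergman_coeff hq hα n).tendsto g).comp hu).sub_const (Q n))
      simp only [Function.comp_apply, bergman_coeff_ofPoly, Finsupp.sub_apply]
    · have h1 := (((continuous_bergman_eval hq hα s).tendsto g).comp hu).sub_const (polyEval s Q)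
      rw [hg s hs, sub_self] at h1
      refine h1.congr fun k => ?_
      simp only [Function.comp_apply, bergman_eval_ofPoly hq hα hs, map_sub]
  set v := (bergmanMeasure α).real (Set.Ioo 0 δ) ^ (1 / q) with hv
  have hv0 : 0 ≤ v := Real.rpow_nonneg measureReal_nonneg _
  have h1 := hu.norm.add (hR.const_mul v)
  rw [mul_zero, add_zero] at h1
  refine ge_of_tendsto' h1 fun k => ?_
  rw [hnorm]
  have h2 := measure_rpow_mul_hardyNorm_le_bergmanNorm hq hα δ (u k)
  have h3 : hardyNorm q (translate δ Q) ≤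
      hardyNorm q (translate δ (u k)) + hardyNorm q (translate δ (u k - Q)) := by
    have := hardyNorm_sub_le hq (translate δ (u k)) (translate δ (u k - Q))
    rwa [← map_sub, sub_sub_cancel] at this
  have := mul_le_mul_of_nonneg_left h3 hv0
  linarith

/-- A lower bound for the norm in terms of the length of the polynomial. -/
lemma exists_hardyNorm_le_log_rpow_mul {q α : ℝ} (hq : 1 ≤ q) (hα : -1 < α) :
    ∃ K : ℝ, 0 < K ∧ ∀ (g : BergmanSpace q α hq hα) (Q : DirichletPoly) (M : ℝ),
      Real.exp 1 ≤ M → (∀ n ∈ Q.support, ((n : ℕ) : ℝ) ≤ M) →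
      (∀ s : ℂ, 1 / 2 < s.re → g.eval s = polyEval s Q) →
      hardyNorm q Q ≤ K * Real.log M ^ ((α + 1) / q) * ‖g‖ := by
  obtain ⟨c, hc, h⟩ := exists_le_bergmanMeasure_Ioo hα
  have hq0 : 0 < q := by linarith
  have hcq : 0 < c ^ (1 / q) := Real.rpow_pos_of_pos hc _
  refine ⟨Real.exp 1 * (c ^ (1 / q))⁻¹, by positivity, fun g Q M hM hQ hg => ?_⟩
  have hM0 : 0 < M := (Real.exp_pos 1).trans_le hM
  have hL : 1 ≤ Real.log M := (Real.le_log_iff_exp_le hM0).mpr hM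
  have hL0 : 0 < Real.log M := by linarith
  -- This choice balances both losses: `M^δ = e`, and the mass of `(0, δ)` is at least a multiple of
  -- `(log M)^{-(α+1)}`. The condition `e ≤ M` ensures `δ ≤ 1`.
  set δ := 1 / Real.log M with hδ
  have hδ0 : 0 < δ := by positivity
  have hδ1 : δ ≤ 1 := (div_le_one hL0).mpr hL
  have h1 := measure_rpow_mul_hardyNorm_le_norm hq hα hg hδ0 hδ1
  have h2 := hardyNorm_le_mul_translate hq hδ0.le hM0 hQ
  have hMδ : M ^ δ = Real.exp 1 := by
    rw [Real.rpow_def_of_pos hM0, hδ, mul_one_div_cancel hL0.ne']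
  rw [hMδ] at h2
  have h3 : c ^ (1 / q) * (Real.log M ^ ((α + 1) / q))⁻¹ ≤
      (bergmanMeasure α).real (Set.Ioo 0 δ) ^ (1 / q) := by
    refine le_trans (le_of_eq ?_) (Real.rpow_le_rpow (by positivity) (h δ hδ0 hδ1)
      (by positivity))
    rw [Real.mul_rpow hc.le (by positivity), ← Real.rpow_mul hδ0.le, hδ, one_div (Real.log M),
      Real.inv_rpow hL0.le, mul_one_div]
  have hLp : 0 < Real.log M ^ ((α + 1) / q) := Real.rpow_pos_of_pos hL0 _
  have h4 := (mul_le_mul_of_nonneg_right h3 (hardyNorm_nonneg q (translate δ Q))).trans h1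
  have h5 : hardyNorm q (translate δ Q) ≤ (c ^ (1 / q))⁻¹ * Real.log M ^ ((α + 1) / q) * ‖g‖ := by
    rw [mul_assoc, le_inv_mul_iff₀ hcq]
    rw [mul_assoc, mul_left_comm, inv_mul_le_iff₀ hLp] at h4
    exact h4
  refine h2.trans ((mul_le_mul_of_nonneg_left h5 (Real.exp_pos 1).le).trans (le_of_eq ?_))
  ring

/-! ### Independence of the coordinates of the torus -/

lemma integrable_prod_of_continuous {f : InfTorus × InfTorus → ℝ} (hf : Continuous f) :
    Integrable f (torusMeasure.prod torusMeasure) :=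
  hf.integrable_of_hasCompactSupport (HasCompactSupport.of_compactSpace f)

/-- Independence follows from invariance alone. Rotating the `j`-th coordinate by `w j` leaves the
integral and `G` unchanged; averaging over `w` in a second copy of the torus and using Fubini turns
`h (w j * z j)` into its mean. -/
lemma integral_coord_mul {h : Circle → ℝ} (hh : Continuous h) {G : InfTorus → ℝ}
    (hG : Continuous G) (j : Nat.Primes) (hGj : ∀ w z, G (Pi.mulSingle j w * z) = G z) :
    ∫ z, h (z j) * G z ∂torusMeasure =
      (∫ z, h (z j) ∂torusMeasure) * ∫ z, G z ∂torusMeasure := by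
  have h1 : ∀ w : InfTorus, ∫ z, h (z j) * G z ∂torusMeasure =
      ∫ z, h (w j * z j) * G z ∂torusMeasure := fun w => by
    rw [← integral_mul_left_eq_self (fun z : InfTorus => h (z j) * G z) (Pi.mulSingle j (w j))]
    simp [hGj]
  have h2 : ∫ z, h (z j) * G z ∂torusMeasure =
      ∫ w : InfTorus, ∫ z, h (w j * z j) * G z ∂torusMeasure ∂torusMeasure := by
    simp only [← h1, integral_const, probReal_univ, one_smul]
  rw [h2, integral_integral_swap (integrable_prod_of_continuous (by
    simp only [Function.uncurry_def]; fun_prop)), ← integral_const_mul]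
  congr 1
  ext z
  rw [integral_mul_const]
  congr 1
  exact integral_mul_right_eq_self (fun w : InfTorus => h (w j)) z

/-- By invariance, both sides equal the double average of `h (w i * z j)`. -/
lemma integral_coord_eq {h : Circle → ℝ} (hh : Continuous h) (i j : Nat.Primes) :
    ∫ z : InfTorus, h (z i) ∂torusMeasure = ∫ z : InfTorus, h (z j) ∂torusMeasure := by
  have h1 : ∀ w : InfTorus, ∫ z : InfTorus, h (z j) ∂torusMeasure =
      ∫ z : InfTorus, h (w i * z j) ∂torusMeasure := fun w => by
    rw [← integral_mul_left_eq_self (fun z : InfTorus => h (z j)) (Pi.mulSingle j (w i))]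
    simp
  have h2 : ∀ z : InfTorus, ∫ w : InfTorus, h (w i) ∂torusMeasure =
      ∫ w : InfTorus, h (w i * z j) ∂torusMeasure := fun z => by
    rw [← integral_mul_right_eq_self (fun w : InfTorus => h (w i)) (Pi.mulSingle i (z j))]
    simp
  calc ∫ z : InfTorus, h (z i) ∂torusMeasure
      = ∫ z : InfTorus, ∫ w : InfTorus, h (w i * z j) ∂torusMeasure ∂torusMeasure := by
        simp only [← h2, integral_const, probReal_univ, one_smul]
    _ = ∫ w : InfTorus, ∫ z : InfTorus, h (w i * z j) ∂torusMeasure ∂torusMeasure :=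
        integral_integral_swap (integrable_prod_of_continuous (by
          simp only [Function.uncurry_def]; fun_prop))
    _ = ∫ z : InfTorus, h (z j) ∂torusMeasure := by
        simp only [← h1, integral_const, probReal_univ, one_smul]

lemma integral_prod_coord {h : Circle → ℝ} (hh : Continuous h) (i : Nat.Primes)
    (S : Finset Nat.Primes) : ∫ z : InfTorus, ∏ j ∈ S, h (z j) ∂torusMeasure =
      (∫ z : InfTorus, h (z i) ∂torusMeasure) ^ S.card := by
  classical
  induction S using Finset.induction_on with
  | empty => simp
  | insert j S hj ih =>
    simp only [Finset.prod_insert hj]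
    rw [integral_coord_mul hh (by fun_prop) j, ih, Finset.card_insert_of_notMem hj, pow_succ',
      integral_coord_eq hh j i]
    intro w z
    refine Finset.prod_congr rfl fun k hk => ?_
    have : k ≠ j := fun h => hj (h ▸ hk)
    simp [Pi.mulSingle_eq_of_ne this]

/-! ### The test polynomials -/

/-- The polynomial with Bohr lift `∏ (1 + z_j)`, where `j` runs through `S`. -/
noncomputable def testPoly (S : Finset Nat.Primes) : DirichletPoly :=
  ∑ T ∈ S.powerset, Finsupp.single (∏ j ∈ T, (j : ℕ+)) 1

lemma bohrLift_testPoly (z : InfTorus) (S : Finset Nat.Primes) :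
    bohrLift z (testPoly S) = ∏ j ∈ S, (1 + (z j : ℂ)) := by
  rw [testPoly, map_sum, Finset.prod_one_add]
  refine Finset.sum_congr rfl fun T _ => ?_
  rw [bohrLift_single, one_mul, map_prod]
  simp only [torusChar_prime]
  exact map_prod Circle.coeHom _ _

/-- The prime `2`. -/
def primeTwo : Nat.Primes := ⟨2, Nat.prime_two⟩

/-- The norm `‖1 + z‖_{L^p}` on the circle. -/
noncomputable def oneAddNorm (p : ℝ) : ℝ :=
  (∫ z : InfTorus, ‖1 + (z primeTwo : ℂ)‖ ^ p ∂torusMeasure) ^ (1 / p)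

/-- The factors `1 + z_j` are independent and identically distributed, so the norm is multiplicative
and the prime `2` may stand for any other. -/
lemma hardyNorm_testPoly {p : ℝ} (hp : 1 ≤ p) (S : Finset Nat.Primes) :
    hardyNorm p (testPoly S) = oneAddNorm p ^ S.card := by
  have hp0 : 0 ≤ p := by linarith
  have hc : Continuous fun w : Circle => ‖1 + (w : ℂ)‖ ^ p :=
    (continuous_const.add continuous_subtype_val).norm.rpow_const fun _ => Or.inr hp0
  have h := integral_prod_coord hc primeTwo S
  have hA : 0 ≤ ∫ z : InfTorus, ‖1 + (z primeTwo : ℂ)‖ ^ p ∂torusMeasure :=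
    integral_nonneg fun _ => Real.rpow_nonneg (norm_nonneg _) _
  rw [oneAddNorm, ← Real.rpow_natCast, ← Real.rpow_mul hA, mul_comm, Real.rpow_mul hA,
    Real.rpow_natCast, ← h, hardyNorm]
  congr 2
  ext z
  rw [bohrLift_testPoly, norm_prod, Real.finsetProd_rpow _ _ fun _ _ => norm_nonneg _]

lemma continuous_norm_one_add_rpow {p : ℝ} (hp : 0 ≤ p) :
    Continuous fun z : InfTorus => ‖1 + (z primeTwo : ℂ)‖ ^ p :=
  (continuous_const.add (continuous_subtype_val.comp (continuous_apply _))).norm.rpow_const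
    fun _ => Or.inr hp

lemma integrable_norm_one_add_rpow {p : ℝ} (hp : 0 ≤ p) :
    Integrable (fun z : InfTorus => ‖1 + (z primeTwo : ℂ)‖ ^ p) torusMeasure :=
  (continuous_norm_one_add_rpow hp).integrable_of_hasCompactSupport
    (HasCompactSupport.of_compactSpace _)

lemma oneAddNorm_pos {p : ℝ} (hp : 1 ≤ p) : 0 < oneAddNorm p := by
  have hp0 : 0 ≤ p := by linarith
  refine Real.rpow_pos_of_pos ?_ _
  refine (continuous_norm_one_add_rpow hp0).integral_pos_of_hasCompactSupport_nonneg_nonzero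
    (HasCompactSupport.of_compactSpace _) (fun _ => Real.rpow_nonneg (norm_nonneg _) _)
    (x := 1) ?_
  have : ‖(1 : ℂ) + 1‖ = 2 := by norm_num
  simp only [Pi.one_apply, Circle.coe_one, this]
  positivity

/-- Strict Jensen inequality for `x ↦ x^{q/p}` applied to `|1 + z|^p`. Equality would make this
continuous function constant, but it is `2^p` at `z = 1` and `0` at `z = -1`. -/
lemma oneAddNorm_strictMono {p q : ℝ} (hp : 1 ≤ p) (hpq : p < q) :
    oneAddNorm p < oneAddNorm q := by
  have hp0 : 0 < p := by linarith
  have hq0 : 0 < q := by linarith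
  set f : InfTorus → ℝ := fun z => ‖1 + (z primeTwo : ℂ)‖ ^ p with hf
  have hf0 : ∀ z, 0 ≤ f z := fun z => Real.rpow_nonneg (norm_nonneg _) _
  have hfq : ∀ z, f z ^ (q / p) = ‖1 + (z primeTwo : ℂ)‖ ^ q := fun z => by
    rw [hf, ← Real.rpow_mul (norm_nonneg _), mul_div_cancel₀ _ hp0.ne']
  have hI : 0 ≤ ∫ z, f z ∂torusMeasure := integral_nonneg hf0
  have h := (strictConvexOn_rpow ((one_lt_div hp0).mpr hpq)).ae_eq_const_or_map_average_lt
    (μ := torusMeasure) (f := f)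
    (Real.continuous_rpow_const (div_pos hq0 hp0).le).continuousOn isClosed_Ici
    (ae_of_all _ hf0) (integrable_norm_one_add_rpow hp0.le)
    (by simpa only [Function.comp_def, hfq] using integrable_norm_one_add_rpow hq0.le)
  rcases h with h | h
  · exfalso
    have h1 := (continuous_norm_one_add_rpow hp0.le).ae_eq_iff_eq torusMeasure
      continuous_const |>.mp h
    have h2 := congrFun h1 1
    have h3 := congrFun h1 fun _ => Circle.exp Real.pi
    have h4 := h2.trans h3.symm
    have h5 : ‖(1 : ℂ) + 1‖ = 2 := by norm_num
    simp only [Pi.one_apply, Circle.coe_one, h5, Circle.coe_exp, Complex.exp_pi_mul_I,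
      add_neg_cancel, norm_zero, Real.zero_rpow hp0.ne'] at h4
    exact (Real.rpow_pos_of_pos two_pos p).ne' h4
  · simp only [average_eq_integral, hfq] at h
    have h1 := Real.rpow_lt_rpow (Real.rpow_nonneg hI _) h (by positivity : 0 < 1 / q)
    rw [← Real.rpow_mul hI] at h1
    rw [oneAddNorm, oneAddNorm]
    convert h1 using 2
    field_simp

/-! ### Length of the test polynomials and failure of the norm comparison. -/

/-- Bertrand's postulate supplies a prime in `(2^k, 2^{k+1}]` for each `k < N`. This crude bound is
enough, since only the polynomial growth in `N` of the logarithm of the length matters. -/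
lemma exists_primes (N : ℕ) :
    ∃ S : Finset Nat.Primes, S.card = N ∧ ∀ p ∈ S, (p : ℕ) ≤ 2 ^ N := by
  classical
  choose r hr1 hr2 hr3 using fun k : ℕ =>
    Nat.exists_prime_lt_and_le_two_mul (2 ^ k) (pow_ne_zero k two_ne_zero)
  have hmono : StrictMono r := strictMono_nat_of_lt_succ fun k =>
    (hr3 k).trans_lt (by rw [← pow_succ']; exact hr2 (k + 1))
  let r' : ℕ → Nat.Primes := fun k => ⟨r k, hr1 k⟩
  have hinj : Function.Injective r' := fun a b h => hmono.injective (congrArg Subtype.val h)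
  refine ⟨(Finset.range N).image r', ?_, fun p hp => ?_⟩
  · rw [Finset.card_image_of_injective _ hinj, Finset.card_range]
  · obtain ⟨k, hk, rfl⟩ := Finset.mem_image.mp hp
    refine (hr3 k).trans ?_
    rw [← pow_succ']
    exact Nat.pow_le_pow_right two_pos (Finset.mem_range.mp hk)

lemma support_testPoly_le {S : Finset Nat.Primes} {N : ℕ} (hS : S.card = N)
    (hN : ∀ p ∈ S, (p : ℕ) ≤ 2 ^ N) : ∀ n ∈ (testPoly S).support, (n : ℕ) ≤ 2 ^ (N * N) := by
  classical
  intro n hn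
  obtain ⟨T, hT, hn'⟩ := Finset.mem_biUnion.mp (Finsupp.support_finsetSum hn)
  have hn1 : n = ∏ j ∈ T, (j : ℕ+) :=
    Finset.mem_singleton.mp (Finsupp.support_single_subset hn')
  have hTS := Finset.mem_powerset.mp hT
  have h1 : (n : ℕ) = ∏ j ∈ T, (j : ℕ) := by
    rw [hn1]
    exact map_prod PNat.coeMonoidHom _ _
  rw [h1, pow_mul]
  refine (Finset.prod_le_pow_card _ _ _ fun j hj => hN j (hTS hj)).trans ?_
  exact Nat.pow_le_pow_right (by positivity) (hS ▸ Finset.card_le_card hTS)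

/-- For `p < q` the `𝓗^q` norm is not dominated by the `𝓗^p` norm, even up to a power of the
logarithm of the length of the polynomial. -/
lemma not_hardyNorm_le_log_pow_mul {p q : ℝ} (hp : 1 ≤ p) (hpq : p < q) (K : ℝ) (b : ℕ) :
    ∃ (F : DirichletPoly) (M : ℝ), Real.exp 1 ≤ M ∧ (∀ n ∈ F.support, ((n : ℕ) : ℝ) ≤ M) ∧
      K * Real.log M ^ b * hardyNorm p F < hardyNorm q F := by
  have hP := oneAddNorm_pos hp
  have hr : 1 < oneAddNorm q / oneAddNorm p := (one_lt_div hP).mpr (oneAddNorm_strictMono hp hpq)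
  -- The exponent is `2 * b` because `log M ≤ N²`, and `|K| + 1` makes the final inequality strict.
  -- The later requirement `N ≥ 2` gives `M ≥ 2^4 ≥ e`.
  have hlim := (isLittleO_pow_const_const_pow_of_one_lt (R := ℝ) (2 * b) hr).bound
    (c := 1 / (|K| + 1)) (by positivity)
  obtain ⟨N, hN, hN2⟩ := (hlim.and (eventually_ge_atTop 2)).exists
  obtain ⟨S, hS, hSN⟩ := exists_primes N
  have hN0 : (0 : ℝ) ≤ N := Nat.cast_nonneg N
  have hN1 : 4 ≤ N * N := Nat.mul_le_mul hN2 hN2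
  have hlog : Real.log ((2 : ℝ) ^ (N * N)) ≤ N ^ 2 := by
    rw [Real.log_pow]
    have := Real.log_two_lt_d9
    push_cast
    nlinarith [mul_self_nonneg (N : ℝ)]
  have hlog0 : 0 ≤ Real.log ((2 : ℝ) ^ (N * N)) := Real.log_nonneg (one_le_pow₀ one_le_two)
  refine ⟨testPoly S, 2 ^ (N * N), ?_, fun n hn => ?_, ?_⟩
  · calc Real.exp 1 ≤ 2 ^ 4 := by linarith [Real.exp_one_lt_d9]
      _ ≤ 2 ^ (N * N) := pow_le_pow_right₀ one_le_two hN1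
  · exact_mod_cast support_testPoly_le hS hSN n hn
  · rw [hardyNorm_testPoly hp, hardyNorm_testPoly (hp.trans hpq.le), hS, ← lt_div_iff₀ (by positivity),
      ← div_pow]
    have hrN : 0 < (oneAddNorm q / oneAddNorm p) ^ N := pow_pos (by linarith) _
    rw [Real.norm_of_nonneg (by positivity), Real.norm_of_nonneg hrN.le, one_div,
      le_inv_mul_iff₀ (by positivity), pow_mul] at hN
    have h1 : Real.log ((2 : ℝ) ^ (N * N)) ^ b ≤ ((N : ℝ) ^ 2) ^ b := pow_le_pow_left₀ hlog0 hlog b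
    have h2 : 0 < ((N : ℝ) ^ 2) ^ b := by
      have : (0 : ℝ) < N := by exact_mod_cast (by omega : 0 < N)
      positivity
    calc K * Real.log ((2 : ℝ) ^ (N * N)) ^ b ≤ |K| * ((N : ℝ) ^ 2) ^ b :=
          mul_le_mul (le_abs_self K) h1 (by positivity) (abs_nonneg K)
      _ < (|K| + 1) * ((N : ℝ) ^ 2) ^ b := by linarith
      _ ≤ _ := hN

/-! ### Necessity of `q ≤ p` -/

/-- The image of a polynomial `F` agrees with `F` on `Re s > 1/2`. The lower bound for Bergman norms
would then dominate `‖F‖_{𝓗^q}` by a power of `log M` times `‖F‖_{𝓗^p}`. -/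
lemma le_of_inclusionBounded {p q β : ℝ} (hp : 1 ≤ p) (hq : 1 ≤ q) (hβ : -1 < β)
    (h : InclusionBounded p q β hp hq hβ) : q ≤ p := by
  by_contra! hpq
  obtain ⟨C, hC⟩ := h
  obtain ⟨K, hK, hKb⟩ := exists_hardyNorm_le_log_rpow_mul hq hβ
  obtain ⟨b, hb⟩ := exists_nat_ge ((β + 1) / q)
  obtain ⟨F, M, hM, hF, hlt⟩ := not_hardyNorm_le_log_pow_mul hp hpq (K * |C|) b
  obtain ⟨g, hg, hge⟩ := hC (SeriesSpace.ofPoly _ F)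
  rw [SeriesSpace.norm_ofPoly] at hg
  have hL : 1 ≤ Real.log M := (Real.le_log_iff_exp_le ((Real.exp_pos 1).trans_le hM)).mpr hM
  have h1 := hKb g F M hM hF fun s hs => by rw [hge s hs, hardy_eval_ofPoly hp hs]
  have h2 : Real.log M ^ ((β + 1) / q) ≤ Real.log M ^ b := by
    rw [← Real.rpow_natCast]
    exact Real.rpow_le_rpow_of_exponent_le hL hb
  have hnn := hardyNorm_nonneg p F
  have h3 : ‖g‖ ≤ |C| * hardyNorm p F :=
    hg.trans (mul_le_mul_of_nonneg_right (le_abs_self C) hnn)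
  have h4 : K * Real.log M ^ ((β + 1) / q) * ‖g‖ ≤
      K * Real.log M ^ b * (|C| * hardyNorm p F) := by
    gcongr
  have h5 := hlt.trans_le (h1.trans h4)
  exact lt_irrefl _ (h5.trans_eq (by ring))

/-- Fractional differentiation: a polynomial whose fractional integral is a given one. -/
lemma exists_fracInt_eq {p t : ℝ} (hp : 1 ≤ p) (ht : 0 < t) :
    ∃ (K : ℝ) (k : ℕ), 0 ≤ K ∧ ∀ (F : DirichletPoly) (M : ℝ), 1 < M →
      (∀ n ∈ F.support, ((n : ℕ) : ℝ) ≤ M) → ∃ P : DirichletPoly, P 1 = 0 ∧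
        fracInt t P = dropConst F ∧ hardyNorm p P ≤ K * Real.log M ^ k * hardyNorm p F := by
  -- Differentiation of order `t` is split into `k > t` whole derivatives, bounded by Bernstein's
  -- inequality, and a fractional integration of order `k - t > 0`.
  obtain ⟨k, hk⟩ := exists_nat_gt t
  have hk0 : k ≠ 0 := by rintro rfl; simp at hk; linarith
  refine ⟨Real.log 2 ^ (-((k : ℝ) - t)) * Real.exp 1 ^ k, k,
    mul_nonneg (Real.rpow_nonneg (Real.log_nonneg one_le_two) _) (by positivity),
    fun F M hM hF => ?_⟩
  set G := multiplier (fun n => (Real.log (n : ℕ) : ℂ) ^ k) F with hG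
  have hG1 : G 1 = 0 := by simp [hG, multiplier_apply, hk0]
  refine ⟨fracInt (k - t) G, by simp [fracInt, multiplier_apply], ?_, ?_⟩
  · rw [hG, fracInt, fracInt, multiplier_multiplier, multiplier_multiplier, dropConst]
    refine multiplier_congr fun n _ => ?_
    split_ifs with hn
    · simp
    · have hl := Real.log_pos (one_lt_of_ne_one hn)
      rw [← Complex.ofReal_pow, ← Complex.ofReal_mul, ← Complex.ofReal_mul, ← Real.rpow_natCast,
        ← Real.rpow_add hl, ← Real.rpow_add hl,
        show (k : ℝ) + (-(k - t) + -t) = 0 by ring, Real.rpow_zero, Complex.ofReal_one]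
  · refine (hardyNorm_fracInt_le hp (sub_pos.mpr hk) hG1).trans ?_
    have h1 := hardyNorm_multiplier_log_pow_le hp hM hF k
    rw [mul_pow] at h1
    have h0 : 0 ≤ Real.log 2 ^ (-((k : ℝ) - t)) := Real.rpow_nonneg (Real.log_nonneg one_le_two) _
    refine (mul_le_mul_of_nonneg_left h1 h0).trans (le_of_eq ?_)
    ring

lemma riemannLiouville_hardy_eval_ofPoly {p t : ℝ} (hp : 1 ≤ p) (ht : 0 < t) {P : DirichletPoly}
    (hP : P 1 = 0) {s : ℂ} (hs : 1 / 2 < s.re) :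
    riemannLiouville t (SeriesSpace.ofPoly (hardySeminorm p hp) P).eval s =
      polyEval s (fracInt t P) := by
  rw [← riemannLiouville_polyEval ht hP, riemannLiouville, riemannLiouville]
  congr 1
  refine setIntegral_congr_fun measurableSet_Ioi fun x hx => ?_
  have hx0 : 0 < x := hx
  rw [hardy_eval_ofPoly hp (by simp; linarith)]

/-- Boundedness is tested on the fractional derivative `P` of the test polynomial `F`, so that `I_t
P` is `F` without its constant term. -/
lemma le_of_riemannLiouvilleBounded {p q α t : ℝ} (hp : 1 ≤ p) (hq : 1 ≤ q) (hα : -1 < α)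
    (ht : 0 < t) (h : RiemannLiouvilleBounded t p q α hp hq hα) : q ≤ p := by
  by_contra! hpq
  obtain ⟨C, hC⟩ := h
  obtain ⟨K, hK, hKb⟩ := exists_hardyNorm_le_log_rpow_mul hq hα
  obtain ⟨K', k, hK', hKb'⟩ := exists_fracInt_eq hp ht
  obtain ⟨b, hb⟩ := exists_nat_ge ((α + 1) / q)
  obtain ⟨F, M, hM, hF, hlt⟩ :=
    -- The summand `1` absorbs the constant term of `F`, whose modulus is at most `‖F‖_{𝓗^p}`.
    not_hardyNorm_le_log_pow_mul hp hpq (K * (|C| * K') + 1) (b + k)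
  have hL : 1 ≤ Real.log M := (Real.le_log_iff_exp_le ((Real.exp_pos 1).trans_le hM)).mpr hM
  obtain ⟨P, hP1, hPF, hPb⟩ := hKb' F M
    (by linarith [Real.add_one_lt_exp one_ne_zero]) hF
  obtain ⟨g, hg, hge⟩ := hC (SeriesSpace.ofPoly _ P) (by rw [hardy_coeff_ofPoly, hP1])
  rw [SeriesSpace.norm_ofPoly] at hg
  have h1 := hKb g (dropConst F) M hM
    (fun n hn => hF n (support_multiplier_subset _ _ hn)) fun s hs => by
      rw [(hge s hs).2, riemannLiouville_hardy_eval_ofPoly hp ht hP1 hs, hPF]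
  have h2 : Real.log M ^ ((α + 1) / q) ≤ Real.log M ^ b := by
    rw [← Real.rpow_natCast]
    exact Real.rpow_le_rpow_of_exponent_le hL hb
  have hnn := hardyNorm_nonneg p F
  have h3 : ‖g‖ ≤ |C| * (K' * Real.log M ^ k * hardyNorm p F) :=
    hg.trans (mul_le_mul (le_abs_self C) hPb (hardyNorm_nonneg p P) (abs_nonneg C))
  have h4 : K * Real.log M ^ ((α + 1) / q) * ‖g‖ ≤
      K * Real.log M ^ b * (|C| * (K' * Real.log M ^ k * hardyNorm p F)) := by
    gcongr
  have h5 : hardyNorm q F ≤ hardyNorm q (dropConst F) + hardyNorm p F := by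
    have h6 := hardyNorm_add_le hq (dropConst F) (Finsupp.single 1 (F 1))
    rw [hardyNorm_single_one hq] at h6
    have h7 : dropConst F + Finsupp.single 1 (F 1) = F := by rw [dropConst_eq, sub_add_cancel]
    rw [h7] at h6
    linarith [norm_coeff_le_hardyNorm hp F 1]
  have h8 : hardyNorm p F ≤ Real.log M ^ (b + k) * hardyNorm p F :=
    le_mul_of_one_le_left hnn (one_le_pow₀ hL)
  have h9 : (K * (|C| * K') + 1) * Real.log M ^ (b + k) * hardyNorm p F =
      K * Real.log M ^ b * (|C| * (K' * Real.log M ^ k * hardyNorm p F)) +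
        Real.log M ^ (b + k) * hardyNorm p F := by
    rw [pow_add]; ring
  linarith

end DirichletSpaces

/-- For `1 ≤ p, q < ∞`, `α > -1` and `t > 0`: the Riemann–Liouville operator
`I_t : 𝓗^p → 𝓐^q_α` is bounded iff the identity `𝓗^p → 𝓐^q_{α+qt}` is bounded iff `p ≥ q`. -/
theorem theorem4p1 (p q α t : ℝ) (hp : 1 ≤ p) (hq : 1 ≤ q) (hα : -1 < α) (ht : 0 < t) :
    List.TFAE
      [DirichletSpaces.RiemannLiouvilleBounded t p q α hp hq hα,
        DirichletSpaces.InclusionBounded p q (α + q * t) hp hq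
          (DirichletSpaces.neg_one_lt_add_mul hα hq ht),
        p ≥ q] := by
  tfae_have 1 → 3 := DirichletSpaces.le_of_riemannLiouvilleBounded hp hq hα ht
  tfae_have 2 → 3 := DirichletSpaces.le_of_inclusionBounded hp hq _
  tfae_have 3 → 1 := DirichletSpaces.riemannLiouvilleBounded_of_le hp hq hα ht
  tfae_have 3 → 2 := DirichletSpaces.inclusionBounded_of_le hp hq _
  tfae_finish
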